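/- Let $(Y_j,X_j)_{j\ge 1}$ be i.i.d. random vectors in $\mathbb R\times\mathbb R^p$ such that $X_1$ takes values almost surely in a compact set $\mathcal R\subset\mathbb R^p$. Let $\Theta\subseteq\mathbb R^q$ be open, and let $\mathcal T_\vartheta:\mathbb R\to\mathbb R$, $\vartheta\in\Theta$, be strictly increasing functions with $E\,\mathcal T_\vartheta(Y_1)^2<\infty$ for all $\vartheta\in\Theta$. Put $m_\vartheta(X)=E(\mathcal T_\vartheta(Y)\mid X)$, $\sigma^2_\vartheta(X)=\mathrm{Var}(\mathcal T_\vartheta(Y)\mid X)$ and $\varepsilon_\vartheta=(\mathcal T_\vartheta(Y)-m_\vartheta(X))/\sigma_\vartheta(X)$. **The statistic.** Let $K(u)=\prod_{s=1}^p k(u_s)$, let $h=h_n>0$, and put $$\widehat f(x)=\frac1{nh^p}\sum_{v=1}^nK\Big(\frac{x-X_v}h\Big),\qquad \widehat m_\vartheta(x)=\frac1{\widehat f(x)}\,\frac1{nh^p}\sum_{v=1}^nK\Big(\frac{x-X_v}h\Big)\mathcal T_\vartheta(Y_v),$$ $$\widehat\sigma^2_\vartheta(x)=\frac1{\widehat f(x)}\,\frac1{nh^p}\sum_{v=1}^nK\Big(\frac{x-X_v}h\Big)\big(\mathcal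 T_\vartheta(Y_v)-\widehat m_\vartheta(x)\big)^2 .$$ Let $\widehat\vartheta=\widehat\vartheta_n$ be $\Theta$-valued random vectors, let $\widehat\varepsilon_j=(\mathcal T_{\widehat\vartheta}(Y_j)-\widehat m_{\widehat\vartheta}(X_j))/\widehat\sigma_{\widehat\vartheta}(X_j)$ (with the conventions $1/0=0$, and $\sqrt a=0$ for $a<0$), let $\widehat\varphi(t_1,t_2)=\frac1n\sum_{j=1}^n\exp\{it_2^\top X_j+it_1\widehat\varepsilon_j\}$, and $$\Delta_{n,W}=n\int_{\mathbb R}\int_{\mathbb R^p}\big|\widehat\varphi(t_1,t_2)-\widehat\varphi(0,t_2)\,\widehat\varphi(t_1,0)\big|^2\,w_1(t_1)w_2(t_2)\,dt_2\,dt_1\in[0,\infty].$$ **Assumptions.** Suppose that $\widehat\vartheta_n\to\vartheta^0$ in probability for some $\vartheta^0\in\Theta$, that $\sigma_{\vartheta^0}(X_1)>0$ almost surely, and: 1. $k$ vanishes outside $[-1,1]$, is symmetric, is continuous on $[-1,1]$, and $\int_{-1}^1u^rk(u)\,du=\delta_{r,0}$ for $r=0,\dots,p$. 2. $(nh^p)^{-1}+nh^{p+\delta}\to0$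 for some $\delta>0$. 3. $E\|X_1\|^2<\infty$, and $X_1$ has a density $f$ with $0<\inf_{\mathcal R}f\le\sup_{\mathcal R}f<\infty$. For some integer $s_1\ge0$ (for instance $s_1=1$), some $\delta_1>0$ and some $d_1$ with $E\,d_1(X_1)^2<\infty$, one has $|f(x)-L(f,y,x-y,s_1)|\le\|x-y\|^{s_1+\delta_1}d_1(y)$ for all $x,y\in\mathcal R$, where $L(f,y,\cdot,s)$ is the Taylor polynomial of order $s$ of $f$ on $\mathcal R$ at $y$. 4. For some integers $s_2,s_3\ge0$ (for instance $1$) and some $\delta_2>0$, the functions $m_{\vartheta^0}$ and $\sigma_{\vartheta^0}$ satisfy on $\mathcal R$ the analogous inequalities, with $\|x-y\|^{s_2+\delta_2}d_2(y)$ and $\|x-y\|^{s_3+\delta_2}d_3(y)$ on the right, where $E\,d_2(X_1)^2<\infty$ and $E\,d_3(X_1)^2<\infty$. Moreover $E\,m_{\vartheta^0}(X_1)^2<\infty$ and $E\,\sigma_{\vartheta^0}(X_1)^2<\infty$. 5. For some $\xi,\delta_4>0$ and some $d_4$ with $E\,d_4(Y_1)^2<\infty$, almost surely for all $\vartheta\in\Theta$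 with $\|\vartheta-\vartheta^0\|\le\xi$, $$\Big|\mathcal T_\vartheta(Y_1)-\mathcal T_{\vartheta^0}(Y_1)-\sum_{s=1}^q(\vartheta_s-\vartheta^0_s)\,\partial_{\vartheta_s}\mathcal T_{\vartheta^0}(Y_1)\Big|\le d_4(Y_1)\,\|\vartheta-\vartheta^0\|^{1+\delta_4}.$$ For each $s$, almost surely $E(\partial_{\vartheta_s}\mathcal T_{\vartheta^0}(Y_1)\mid X_1)=\partial_{\vartheta_s}m_\vartheta(X_1)|_{\vartheta=\vartheta^0}$, and this variable is square integrable. 6. $w_1,w_2$ are nonnegative, measurable and symmetric ($w_m(-t)=w_m(t)$), and $\int t^2w_1(t)\,dt<\infty$. 7. For some $d_5$ with $E|d_5(Y_1)|<\infty$ and all $\vartheta\in\Theta$, $|\mathcal T_\vartheta(Y_1)-\mathcal T_{\vartheta^0}(Y_1)|\le d_5(Y_1)\|\vartheta-\vartheta^0\|$ almost surely. Let $\varphi_{X,\varepsilon_{\vartheta^0}},\varphi_X,\varphi_{\varepsilon_{\vartheta^0}}$ be the joint and the marginal characteristic functions of $X_1$ and $\varepsilon_{\vartheta^0}$, and suppose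 that $$D:=\int_{\mathbb R}\int_{\mathbb R^p}\big|\varphi_{X,\varepsilon_{\vartheta^0}}(t_2,t_1)-\varphi_X(t_2)\varphi_{\varepsilon_{\vartheta^0}}(t_1)\big|^2\,w_1(t_1)w_2(t_2)\,dt_2\,dt_1>0.$$ **Conclusion.** As $n\to\infty$, $\Delta_{n,W}\to\infty$ in probability. If $w_1$ and $w_2$ are integrable, then $D<\infty$ and $\Delta_{n,W}/n\to D$ in probability. The test is consistent: for all (possibly random) critical values $c_n$ that are bounded from above in probability, $P(\Delta_{n,W}>c_n)\to1$. -/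

import Mathlib

open MeasureTheory ProbabilityTheory Filter Topology
open scoped ENNReal

noncomputable section

namespace TransformationTest

/-- `ℝ^d` with the Euclidean norm. -/
abbrev Vec (d : ℕ) := EuclideanSpace ℝ (Fin d)

/-! ### The test statistic, as a function of the data

A realized sample of size `n` consists of the first `n` terms of `y : ℕ → ℝ` and `x : ℕ → Vec p`. -/

section Statistic

variable {p q : ℕ}

/-- The product kernel `K(u) = ∏ k(u_s)`. -/
def productKernel (k : ℝ → ℝ) (u : Vec p) : ℝ := ∏ s, k (u s)

/-- `(n h^p)⁻¹ ∑_{v<n} K((a - x_v)/h) g_v`. -/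
def kernelAverage (n : ℕ) (h : ℝ) (k : ℝ → ℝ) (x : ℕ → Vec p) (g : ℕ → ℝ) (a : Vec p) : ℝ :=
  (n * h ^ p)⁻¹ * ∑ v ∈ Finset.range n, productKernel k (h⁻¹ • (a - x v)) * g v

/-- Kernel estimator of the density of the covariates. -/
def densityEst (n : ℕ) (h : ℝ) (k : ℝ → ℝ) (x : ℕ → Vec p) (a : Vec p) : ℝ :=
  kernelAverage n h k x (fun _ => 1) a

/-- Kernel estimator of the regression function of the transformed response; `τ` is the
transformation in use. -/
def meanEst (n : ℕ) (h : ℝ) (k : ℝ → ℝ) (τ : ℝ → ℝ) (y : ℕ → ℝ) (x : ℕ → Vec p) (a : Vec p) : ℝ :=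
  (densityEst n h k x a)⁻¹ * kernelAverage n h k x (fun v => τ (y v)) a

/-- Kernel estimator of the conditional variance of the transformed response. -/
def varEst (n : ℕ) (h : ℝ) (k : ℝ → ℝ) (τ : ℝ → ℝ) (y : ℕ → ℝ) (x : ℕ → Vec p) (a : Vec p) : ℝ :=
  (densityEst n h k x a)⁻¹ *
    kernelAverage n h k x (fun v => (τ (y v) - meanEst n h k τ y x a) ^ 2) a

/-- The `j`-th residual, computed with the transformation `τ`. -/
def residual (n : ℕ) (h : ℝ) (k : ℝ → ℝ) (τ : ℝ → ℝ) (y : ℕ → ℝ) (x : ℕ → Vec p) (j : ℕ) : ℝ :=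
  (τ (y j) - meanEst n h k τ y x (x j)) / √(varEst n h k τ y x (x j))

/-- Joint empirical characteristic function of the pairs `(x_j, e_j)`, `j < n`. -/
def empiricalCF (n : ℕ) (x : ℕ → Vec p) (e : ℕ → ℝ) (t₁ : ℝ) (t₂ : Vec p) : ℂ :=
  (n : ℂ)⁻¹ * ∑ j ∈ Finset.range n,
    Complex.exp (Complex.I * ((inner ℝ t₂ (x j) + t₁ * e j : ℝ) : ℂ))

/-- The test statistic
`n ∫∫ |φ̂(t₁,t₂) - φ̂_X(t₂) φ̂_e(t₁)|² w₁(t₁) w₂(t₂) dt₁ dt₂`, with values in `[0,∞]`; here `e` are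
the residuals for the transformation `τ`. -/
def testStatistic (n : ℕ) (h : ℝ) (k : ℝ → ℝ) (w₁ : ℝ → ℝ) (w₂ : Vec p → ℝ) (τ : ℝ → ℝ)
    (y : ℕ → ℝ) (x : ℕ → Vec p) : ℝ≥0∞ :=
  n * ∫⁻ t : ℝ × Vec p, ENNReal.ofReal
    (‖empiricalCF n x (residual n h k τ y x) t.1 t.2
        - empiricalCF n x (residual n h k τ y x) 0 t.2
          * empiricalCF n x (residual n h k τ y x) t.1 0‖ ^ 2 * (w₁ t.1 * w₂ t.2))

end Statistic

/-! ### Population quantities -/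

section Population

variable {Ω : Type*} [MeasurableSpace Ω] {p q : ℕ}

/-- `g` is a version of the regression function `E(Z | X = ·)`. -/
def IsCondMean (μ : Measure Ω) (X : Ω → Vec p) (Z : Ω → ℝ) (g : Vec p → ℝ) : Prop :=
  Measurable g ∧ (fun ω => g (X ω)) =ᵐ[μ] μ[Z | MeasurableSpace.comap X inferInstance]

/-- `g` is a version of the conditional standard deviation `Var(Z | X = ·)^{1/2}`. -/
def IsCondSD (μ : Measure Ω) (X : Ω → Vec p) (Z : Ω → ℝ) (g : Vec p → ℝ) : Prop :=
  Measurable g ∧ (∀ a, 0 ≤ g a) ∧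
    (fun ω => g (X ω) ^ 2) =ᵐ[μ] condVar (MeasurableSpace.comap X inferInstance) Z μ

/-- The error `(τ(Y) - m(X)) / σ(X)`. -/
def modelError (τ : ℝ → ℝ) (m σ : Vec p → ℝ) (Y : Ω → ℝ) (X : Ω → Vec p) (ω : Ω) : ℝ :=
  (τ (Y ω) - m (X ω)) / σ (X ω)

/-- Joint characteristic function `E exp(i t₂ᵀX + i t₁ ε)`. -/
def jointCF (μ : Measure Ω) (X : Ω → Vec p) (ε : Ω → ℝ) (t₁ : ℝ) (t₂ : Vec p) : ℂ :=
  ∫ ω, Complex.exp (Complex.I * ((inner ℝ t₂ (X ω) + t₁ * ε ω : ℝ) : ℂ)) ∂μ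

/-- The weighted `L²` distance `∫∫ |φ_{X,ε} - φ_X φ_ε|² w₁ w₂` between the joint characteristic
function and the product of the marginal ones, with values in `[0,∞]`. -/
def cfDistance (μ : Measure Ω) (X : Ω → Vec p) (ε : Ω → ℝ) (w₁ : ℝ → ℝ) (w₂ : Vec p → ℝ) : ℝ≥0∞ :=
  ∫⁻ t : ℝ × Vec p, ENNReal.ofReal
    (‖jointCF μ X ε t.1 t.2 - charFun (μ.map X) t.2 * charFun (μ.map ε) t.1‖ ^ 2
      * (w₁ t.1 * w₂ t.2))

end Population

/-! ### Assumptions -/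

section Assumptions

variable {Ω : Type*} [MeasurableSpace Ω] {p q : ℕ}

/-- `(Y_j, X_j)` are i.i.d. random vectors, and the covariates lie in the compact set `R`. -/
structure IIDSample (μ : Measure Ω) (Y : ℕ → Ω → ℝ) (X : ℕ → Ω → Vec p) (R : Set (Vec p)) :
    Prop where
  measurable_Y : ∀ j, Measurable (Y j)
  measurable_X : ∀ j, Measurable (X j)
  indep : iIndepFun (fun j ω => (Y j ω, X j ω)) μ
  ident : ∀ j, IdentDistrib (fun ω => (Y j ω, X j ω)) (fun ω => (Y 0 ω, X 0 ω)) μ μ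
  compact : IsCompact R
  mem : ∀ᵐ ω ∂μ, X 0 ω ∈ R

/-- The univariate kernel is supported in `[-1,1]`, symmetric, continuous on `[-1,1]`, integrates
to one, and its moments of orders `1, …, p` vanish. -/
structure KernelCondition (p : ℕ) (k : ℝ → ℝ) : Prop where
  symm : ∀ u, k (-u) = k u
  cont : ContinuousOn k (Set.Icc (-1) 1)
  supp : ∀ u, u ∉ Set.Icc (-1 : ℝ) 1 → k u = 0
  moment : ∀ r ≤ p, ∫ u in (-1 : ℝ)..1, u ^ r * k u = if r = 0 then 1 else 0

/-- Positive bandwidths with `(n h^p)⁻¹ + n h^(p+δ) → 0` for some `δ > 0`. -/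
def BandwidthCondition (p : ℕ) (h : ℕ → ℝ) : Prop :=
  (∀ n, 0 < h n) ∧ ∃ δ > (0 : ℝ),
    Tendsto (fun n : ℕ => ((n : ℝ) * h n ^ p)⁻¹ + n * h n ^ ((p : ℝ) + δ)) atTop (𝓝 0)

/-- Taylor polynomial of order `s` of `g` (a function on `R`) at `b`, evaluated at the
increment `z`. -/
def taylorPoly (R : Set (Vec p)) (g : Vec p → ℝ) (s : ℕ) (b z : Vec p) : ℝ :=
  ∑ i ∈ Finset.range (s + 1), (i.factorial : ℝ)⁻¹ * iteratedFDerivWithin ℝ i g R b (fun _ => z)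

/-- Taylor approximation of order `s` on `R` with remainder `‖a - b‖^(s+δ) d(b)`. -/
def TaylorBound (R : Set (Vec p)) (g : Vec p → ℝ) (s : ℕ) (δ : ℝ) (d : Vec p → ℝ) : Prop :=
  ∀ a ∈ R, ∀ b ∈ R, |g a - taylorPoly R g s b (a - b)| ≤ ‖a - b‖ ^ ((s : ℝ) + δ) * d b

/-- The covariates have a second moment and a density `f` that is bounded and bounded away from
zero on `R` and has Taylor approximations of some order there, with square integrable constants.
Every order is admitted, so the condition is weaker than the one for a prescribed order. -/
structure DensityCondition (μ : Measure Ω) (X₀ : Ω → Vec p) (R : Set (Vec p)) (f : Vec p → ℝ) :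
    Prop where
  second_moment : Integrable (fun ω => ‖X₀ ω‖ ^ 2) μ
  measurable : Measurable f
  nonneg : ∀ a, 0 ≤ f a
  density : μ.map X₀ = volume.withDensity (fun a => ENNReal.ofReal (f a))
  bounds : ∃ c C : ℝ, 0 < c ∧ ∀ a ∈ R, c ≤ f a ∧ f a ≤ C
  taylor : ∃ (s : ℕ) (δ : ℝ) (d : Vec p → ℝ), 0 < δ ∧ TaylorBound R f s δ d ∧
    MemLp d 2 (μ.map X₀)

/-- The regression function `m` and the scale function `σ` are square integrable, have Taylor
approximations of some orders on `R`, with square integrable constants, and `σ(X) > 0` a.s. -/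
structure RegressionCondition (μ : Measure Ω) (X₀ : Ω → Vec p) (R : Set (Vec p))
    (m σ : Vec p → ℝ) : Prop where
  taylor : ∃ (s₂ s₃ : ℕ) (δ : ℝ) (d₂ d₃ : Vec p → ℝ), 0 < δ ∧
    TaylorBound R m s₂ δ d₂ ∧ TaylorBound R σ s₃ δ d₃ ∧
    MemLp d₂ 2 (μ.map X₀) ∧ MemLp d₃ 2 (μ.map X₀)
  mean_sq : MemLp (fun ω => m (X₀ ω)) 2 μ
  sd_sq : MemLp (fun ω => σ (X₀ ω)) 2 μ
  sd_pos : ∀ᵐ ω ∂μ, 0 < σ (X₀ ω)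

/-- Partial derivative `∂ T_θ(y) / ∂ θ_s` at `θ = θ⁰`. -/
def paramDeriv (T : Vec q → ℝ → ℝ) (θ₀ : Vec q) (s : Fin q) (y : ℝ) : ℝ :=
  lineDeriv ℝ (fun θ => T θ y) θ₀ (EuclideanSpace.single s 1)

/-- First order smoothness of the transformations in the parameter at `θ⁰`. Here `m θ` is a version
of `E(T_θ(Y) | X = ·)`. The almost sure finiteness of `E(|d(Y)| | X)` follows from the square
integrability of `d(Y)`. -/
structure SmoothTransformations (μ : Measure Ω) (Y₀ : Ω → ℝ) (X₀ : Ω → Vec p) (Θ : Set (Vec q))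
    (T : Vec q → ℝ → ℝ) (m : Vec q → Vec p → ℝ) (θ₀ : Vec q) : Prop where
  open_params : IsOpen Θ
  strictMono : ∀ θ ∈ Θ, StrictMono (T θ)
  expansion : ∃ (ξ δ : ℝ) (d : ℝ → ℝ), 0 < ξ ∧ 0 < δ ∧ MemLp d 2 (μ.map Y₀) ∧
    ∀ᵐ y ∂(μ.map Y₀), ∀ θ ∈ Θ, ‖θ - θ₀‖ ≤ ξ →
      |T θ y - T θ₀ y - ∑ s, (θ s - θ₀ s) * paramDeriv T θ₀ s y| ≤ d y * ‖θ - θ₀‖ ^ (1 + δ)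
  deriv_comm : ∀ s : Fin q, ∀ᵐ ω ∂μ,
    HasLineDerivAt ℝ (fun θ => m θ (X₀ ω))
      ((μ[fun ω => paramDeriv T θ₀ s (Y₀ ω) | MeasurableSpace.comap X₀ inferInstance]) ω)
      θ₀ (EuclideanSpace.single s 1)
  deriv_sq : ∀ s : Fin q,
    MemLp (μ[fun ω => paramDeriv T θ₀ s (Y₀ ω) | MeasurableSpace.comap X₀ inferInstance]) 2 μ
  sq_integrable : ∀ θ ∈ Θ, MemLp (fun ω => T θ (Y₀ ω)) 2 μ

/-- The product weight `w₁(t₁) w₂(t₂)`: nonnegative symmetric factors with `∫ t² w₁(t) dt < ∞`. -/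
structure WeightCondition (w₁ : ℝ → ℝ) (w₂ : Vec p → ℝ) : Prop where
  measurable₁ : Measurable w₁
  measurable₂ : Measurable w₂
  nonneg₁ : ∀ t, 0 ≤ w₁ t
  nonneg₂ : ∀ t, 0 ≤ w₂ t
  symm₁ : ∀ t, w₁ (-t) = w₁ t
  symm₂ : ∀ t, w₂ (-t) = w₂ t
  moment : Integrable (fun t => t ^ 2 * w₁ t)

/-- The transformations are strictly increasing, the parameter set is open, and the
transformations are Lipschitz at `θ⁰` with an integrable constant. -/
structure LipschitzTransformations (μ : Measure Ω) (Y₀ : Ω → ℝ) (Θ : Set (Vec q))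
    (T : Vec q → ℝ → ℝ) (θ₀ : Vec q) : Prop where
  open_params : IsOpen Θ
  strictMono : ∀ θ ∈ Θ, StrictMono (T θ)
  bound : ∃ d : ℝ → ℝ, Integrable d (μ.map Y₀) ∧
    ∀ θ ∈ Θ, ∀ᵐ y ∂(μ.map Y₀), |T θ y - T θ₀ y| ≤ d y * ‖θ - θ₀‖

end Assumptions

/-! ### Convergence -/

section Convergence

variable {Ω : Type*} [MeasurableSpace Ω]

/-- Convergence in probability of `[0,∞]`-valued quantities to a constant `c ∈ [0,∞]`: every
neighbourhood of `c` is missed with a probability that tends to zero. For `c = ∞` this is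
divergence to infinity in probability. -/
def TendstoInProb (μ : Measure Ω) (Z : ℕ → Ω → ℝ≥0∞) (c : ℝ≥0∞) : Prop :=
  ∀ U ∈ 𝓝 c, Tendsto (fun n => μ {ω | Z n ω ∉ U}) atTop (𝓝 0)

/-- The (possibly random) quantities `c n` are bounded from above in probability. -/
def BoundedAboveInProb (μ : Measure Ω) (c : ℕ → Ω → ℝ) : Prop :=
  ∀ η : ℝ≥0∞, 0 < η → ∃ C : ℝ, ∀ᶠ n in atTop, μ {ω | C < c n ω} ≤ η

end Convergence

end TransformationTest

end

/-! Under the alternative only a law of large numbers is needed, not the asymptotic distribution of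
the statistic, so $L^1$ arguments without rates suffice.

With the true errors in place of the residuals, the empirical contrast
$\hat\varphi_{X,\varepsilon}-\hat\varphi_X\hat\varphi_\varepsilon$ converges pointwise in $L^1$ to
its population counterpart. Both are bounded by 2, so dominated convergence integrates this against
any finite measure in $t$ (`tendsto_lintegral_contrast_sub`). Since $e\mapsto e^{ite}$ is bounded
and Lipschitz, replacing errors by residuals costs only the average of
$\min(1,|\hat\varepsilon_j-\varepsilon_j|)$, and it remains to show that this average tends to zero
in probability (`tendsto_measure_truncDist_residual`).

A residual is a fixed function `studentize` of $T_{\hat\theta}(Y_j)$ and of the kernel averages of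
$1$, $T_{\hat\theta}(Y)$, $T_{\hat\theta}(Y)^2$ at $X_j$. At $\theta_0$ these averages converge in
$L^1$, uniformly in $j<n$, to $f$, $mf$, $(m^2+\sigma^2)f$ at $X_j$
(`eventually_lintegral_kernel_average_sub_le`). The bias vanishes because the kernel is an
approximate identity in $L^1$, so the boundary of $R$ needs no separate treatment. The stochastic
part vanishes by Chebyshev after truncation, because $nh^p\to\infty$. A square integrable Lipschitz
envelope handles the passage from $\theta_0$ to $\hat\theta$. As `studentize` is continuous where
density and variance are positive, which has full probability for the limit, a compactness argument
carries the convergence over (`tendsto_measure_truncDist_of_continuousOn`).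

If the weights are integrable, they define a finite measure and the limit $D$ of $\Delta_{n,W}/n$
follows. In general the weight measure is only $\sigma$-finite. It is then restricted to a set of
finite measure on which the population integral is still positive; the restricted statistic is a
lower bound that grows like $n$. -/

noncomputable section

namespace TransformationTest

variable {p : ℕ}

/-- The rescaled kernel `h^(-p) K(z / h)`. -/
def scaledKernel (k : ℝ → ℝ) (h : ℝ) (z : Vec p) : ℝ := (h ^ p)⁻¹ * productKernel k (h⁻¹ • z)

lemma kernelAverage_eq_sum_scaledKernel (n : ℕ) (h : ℝ) (k : ℝ → ℝ) (x : ℕ → Vec p) (g : ℕ → ℝ)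
    (a : Vec p) :
    kernelAverage n h k x g a
      = (n : ℝ)⁻¹ * ∑ v ∈ Finset.range n, scaledKernel k h (a - x v) * g v := by
  simp only [kernelAverage, scaledKernel, Finset.mul_sum, mul_inv]
  exact Finset.sum_congr rfl fun _ _ => by ring

/-! ### Measurability, boundedness and integral of the kernel -/

namespace KernelCondition

variable {k : ℝ → ℝ}

/-- The kernel may jump at $\pm1$, so regularity is obtained on the compact interval and extended by
zero. -/
lemma eq_indicator (hk : KernelCondition p k) : k = (Set.Icc (-1 : ℝ) 1).indicator k := by
  ext u
  by_cases hu : u ∈ Set.Icc (-1 : ℝ) 1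
  · rw [Set.indicator_of_mem hu]
  · rw [Set.indicator_of_notMem hu, hk.supp u hu]

lemma integrable (hk : KernelCondition p k) : Integrable k := by
  rw [hk.eq_indicator, integrable_indicator_iff measurableSet_Icc]
  exact hk.cont.integrableOn_compact isCompact_Icc

lemma measurable (hk : KernelCondition p k) : Measurable k := by
  rw [hk.eq_indicator]
  refine measurable_of_restrict_of_restrict_compl (s := Set.Icc (-1 : ℝ) 1) measurableSet_Icc ?_ ?_
  · have : (Set.Icc (-1 : ℝ) 1).domRestrict ((Set.Icc (-1 : ℝ) 1).indicator k)
        = (Set.Icc (-1 : ℝ) 1).domRestrict k := by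
      ext x; exact Set.indicator_of_mem x.2 _
    rw [this]
    exact hk.cont.domRestrict.measurable
  · have : (Set.Icc (-1 : ℝ) 1)ᶜ.domRestrict ((Set.Icc (-1 : ℝ) 1).indicator k) = fun _ => 0 := by
      ext x; exact Set.indicator_of_notMem x.2 _
    rw [this]
    exact measurable_const

lemma exists_bound (hk : KernelCondition p k) : ∃ M : ℝ, 0 < M ∧ ∀ u, |k u| ≤ M := by
  obtain ⟨M, hM⟩ := isCompact_Icc.exists_bound_of_continuousOn hk.cont
  refine ⟨max M 1, by positivity, fun u => ?_⟩
  by_cases hu : u ∈ Set.Icc (-1 : ℝ) 1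
  · exact (hM u hu).trans (le_max_left _ _)
  · rw [hk.supp u hu]; simp

lemma integral_eq_one (hk : KernelCondition p k) : ∫ u, k u = 1 := by
  have h := hk.moment 0 (Nat.zero_le _)
  simp only [pow_zero, one_mul, if_true] at h
  rw [intervalIntegral.integral_of_le (by norm_num), ← integral_Icc_eq_integral_Ioc] at h
  rw [hk.eq_indicator, integral_indicator measurableSet_Icc, h]

lemma measurable_productKernel (hk : KernelCondition p k) :
    Measurable (productKernel (p := p) k) := by
  unfold productKernel
  have := hk.measurable
  fun_prop

lemma exists_bound_productKernel (hk : KernelCondition p k) :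
    ∃ M : ℝ, 0 < M ∧ ∀ u : Vec p, |productKernel k u| ≤ M := by
  obtain ⟨M, hM, hb⟩ := hk.exists_bound
  refine ⟨M ^ p, by positivity, fun u => ?_⟩
  rw [productKernel, Finset.abs_prod]
  exact (Finset.prod_le_prod (fun _ _ => abs_nonneg _) fun s _ => hb (u s)).trans (by simp)

/-- The change from the Euclidean space to the plain product preserves volume, which makes Fubini
for products of functions available. -/
lemma productKernel_comp (k : ℝ → ℝ) :
    productKernel (p := p) k
      = (fun u : Fin p → ℝ => ∏ s, k (u s)) ∘ (MeasurableEquiv.toLp 2 (Fin p → ℝ)).symm := rfl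

lemma integrable_productKernel (hk : KernelCondition p k) :
    Integrable (productKernel (p := p) k) := by
  rw [productKernel_comp]
  exact (EuclideanSpace.volume_preserving_symm_measurableEquiv_toLp (Fin p))
    |>.integrable_comp_emb (MeasurableEquiv.measurableEmbedding _) |>.2
    (Integrable.fintype_prod fun _ => hk.integrable)

lemma integral_productKernel (hk : KernelCondition p k) :
    ∫ u : Vec p, productKernel k u = 1 := by
  rw [productKernel_comp]
  have := (EuclideanSpace.volume_preserving_symm_measurableEquiv_toLp (Fin p)
    ).integral_comp (MeasurableEquiv.measurableEmbedding _)
    (fun u : Fin p → ℝ => ∏ s, k (u s))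
  refine Eq.trans this ?_
  rw [integral_fintype_prod_volume_eq_pow, hk.integral_eq_one, one_pow]

end KernelCondition

/-! ### The rescaled kernel as an approximate identity in $L^1$ -/

lemma measurable_scaledKernel {k : ℝ → ℝ} (hk : Measurable (productKernel (p := p) k)) (h : ℝ) :
    Measurable (scaledKernel (p := p) k h) := by
  unfold scaledKernel
  fun_prop

lemma integral_scaledKernel_mul (k : ℝ → ℝ) {h : ℝ} (hh : 0 < h) (φ : Vec p → ℝ) :
    ∫ z, scaledKernel k h z * φ z = ∫ u : Vec p, productKernel k u * φ (h • u) := by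
  have := Measure.integral_comp_inv_smul_of_nonneg (volume : Measure (Vec p))
    (fun u => productKernel k u * φ (h • u)) hh.le
  simp only [smul_smul, mul_inv_cancel₀ hh.ne', one_smul, finrank_euclideanSpace,
    Fintype.card_fin, smul_eq_mul] at this
  simp only [scaledKernel, mul_assoc]
  rw [integral_const_mul, this, inv_mul_cancel_left₀ (by positivity)]

lemma integrable_scaledKernel {k : ℝ → ℝ} (hk : Integrable (productKernel (p := p) k)) {h : ℝ}
    (hh : 0 < h) : Integrable (scaledKernel (p := p) k h) :=
  ((integrable_comp_smul_iff volume _ (inv_ne_zero hh.ne')).2 hk).const_mul _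

lemma lintegral_scaledKernel {k : ℝ → ℝ} (hk : Integrable (productKernel (p := p) k)) {h : ℝ}
    (hh : 0 < h) :
    ∫⁻ z : Vec p, ‖scaledKernel k h z‖ₑ = ∫⁻ u : Vec p, ‖productKernel k u‖ₑ := by
  rw [← ofReal_integral_norm_eq_lintegral_enorm hk,
    ← ofReal_integral_norm_eq_lintegral_enorm (integrable_scaledKernel hk hh)]
  have := Measure.integral_comp_inv_smul_of_nonneg (volume : Measure (Vec p))
    (fun u => ‖productKernel k u‖) hh.le
  simp only [finrank_euclideanSpace, Fintype.card_fin, smul_eq_mul] at this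
  simp only [scaledKernel, norm_mul]
  rw [integral_const_mul, this, Real.norm_of_nonneg (by positivity),
    inv_mul_cancel_left₀ (by positivity)]

/-- Translations are continuous in `L¹`. -/
lemma tendsto_lintegral_translate_sub {F : Vec p → ℝ} (hF : Integrable F) :
    Tendsto (fun y : Vec p => ∫⁻ x, ‖F (x - y) - F x‖ₑ) (𝓝 0) (𝓝 0) := by
  have : Fact ((1 : ℝ≥0∞) ≠ ∞) := ⟨ENNReal.one_ne_top⟩
  have hm : MemLp F 1 volume := memLp_one_iff_integrable.2 hF
  -- Translation by $y$ is the additive action of `DomAddAct.mk (-y)` on $L^1$, and this action is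
  -- continuous.
  have hc : Continuous fun y : Vec p =>
      DomAddAct.mk (-y) +ᵥ (hm.toLp F : Lp ℝ 1 (volume : Measure (Vec p))) := by
    have : Continuous fun y : Vec p => DomAddAct.mk (-y) :=
      DomAddAct.continuous_mk.comp continuous_neg
    exact this.vadd continuous_const
  have h0 := (hc.edist (continuous_const (y := (hm.toLp F : Lp ℝ 1 (volume : Measure (Vec p)))))
    ).tendsto 0
  have he : ∀ y : Vec p, edist (DomAddAct.mk (-y) +ᵥ
      (hm.toLp F : Lp ℝ 1 (volume : Measure (Vec p)))) (hm.toLp F) =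
      ∫⁻ x, ‖F (x - y) - F x‖ₑ := by
    intro y
    rw [DomAddAct.mk_vadd_toLp, Lp.edist_toLp_toLp, eLpNorm_one_eq_lintegral_enorm]
    simp [sub_eq_neg_add]
  simp only [he] at h0
  simpa using h0

/-- A rescaled integrable kernel of integral one is an approximate identity in `L¹`. -/
lemma tendsto_lintegral_scaledKernel_conv_sub {k : ℝ → ℝ}
    (hkm : Measurable (productKernel (p := p) k)) (hk : Integrable (productKernel (p := p) k))
    (hk1 : ∫ u : Vec p, productKernel k u = 1) {h : ℕ → ℝ} (hpos : ∀ n, 0 < h n)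
    (hh : Tendsto h atTop (𝓝 0)) {F : Vec p → ℝ} (hFm : Measurable F) (hF : Integrable F) :
    Tendsto (fun n => ∫⁻ x, ‖(∫ a, scaledKernel k (h n) (x - a) * F a) - F x‖ₑ) atTop (𝓝 0) := by
  -- The $L^1$ modulus of continuity of $F$. As $\int K=1$, Tonelli bounds the error by
  -- $\int|K(u)|\,\omega(hu)\,du$, which is dominated by $2\|F\|_1|K|$.
  set ω : Vec p → ℝ≥0∞ := fun y => ∫⁻ x, ‖F (x - y) - F x‖ₑ with hω
  have hωm : Measurable ω := by
    refine Measurable.lintegral_prod_right' (f := fun z : Vec p × Vec p => ‖F (z.2 - z.1) - F z.2‖ₑ) ?_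
    fun_prop
  have hωb : ∀ y, ω y ≤ 2 * ∫⁻ x, ‖F x‖ₑ := by
    intro y
    calc ω y ≤ ∫⁻ x, (‖F (x - y)‖ₑ + ‖F x‖ₑ) := lintegral_mono fun x => enorm_sub_le
      _ = (∫⁻ x, ‖F (x - y)‖ₑ) + ∫⁻ x, ‖F x‖ₑ := lintegral_add_right _ hFm.enorm
      _ = 2 * ∫⁻ x, ‖F x‖ₑ := by
        rw [lintegral_sub_right_eq_self (fun x => ‖F x‖ₑ) y, two_mul]
  have hFfin : ∫⁻ x, ‖F x‖ₑ ≠ ∞ := hF.2.ne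
  have key : ∀ n, ∫⁻ x, ‖(∫ a, scaledKernel k (h n) (x - a) * F a) - F x‖ₑ
      ≤ ∫⁻ u : Vec p, ‖productKernel k u‖ₑ * ω (h n • u) := by
    intro n
    have hconv : ∀ x, ∫ a, scaledKernel k (h n) (x - a) * F a
        = ∫ u : Vec p, productKernel k u * F (x - h n • u) := by
      intro x
      rw [← integral_scaledKernel_mul k (hpos n) (fun z => F (x - z)),
        ← integral_sub_left_eq_self (fun a => scaledKernel k (h n) a * F (x - a)) volume x]
      simp
    -- $F$ is only integrable, so absolute convergence of the convolution is taken for almost every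
    -- $x$.
    have hint : ∀ᵐ x, Integrable fun u : Vec p => productKernel k u * F (x - h n • u) := by
      have h1 := (integrable_scaledKernel hk (hpos n)).ae_convolution_exists
        (ContinuousLinearMap.mul ℝ ℝ) hF
      filter_upwards [h1] with x hx
      have hx' : Integrable fun z => scaledKernel k (h n) z * F (x - z) := hx
      have h2 := ((integrable_comp_smul_iff volume _ (hpos n).ne').2 hx').const_mul (h n ^ p)
      refine h2.congr (ae_of_all _ fun u => ?_)
      have := (pow_pos (hpos n) p).ne'
      simp only [scaledKernel, smul_smul, inv_mul_cancel₀ (hpos n).ne', one_smul]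
      field_simp
    calc ∫⁻ x, ‖(∫ a, scaledKernel k (h n) (x - a) * F a) - F x‖ₑ
        ≤ ∫⁻ x, ∫⁻ u : Vec p, ‖productKernel k u‖ₑ * ‖F (x - h n • u) - F x‖ₑ := by
          refine lintegral_mono_ae ?_
          filter_upwards [hint] with x hx
          have : (∫ a, scaledKernel k (h n) (x - a) * F a) - F x
              = ∫ u : Vec p, productKernel k u * (F (x - h n • u) - F x) := by
            simp only [mul_sub]
            rw [integral_sub hx (hk.mul_const _), integral_mul_const, hk1, hconv, one_mul]
          rw [this]
          refine (enorm_integral_le_lintegral_enorm _).trans (lintegral_mono fun u => ?_)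
          rw [enorm_mul]
      _ = ∫⁻ u : Vec p, ∫⁻ x, ‖productKernel k u‖ₑ * ‖F (x - h n • u) - F x‖ₑ := by
          refine lintegral_lintegral_swap ?_
          refine Measurable.aemeasurable ?_
          unfold Function.uncurry
          fun_prop
      _ = _ := by
          refine lintegral_congr fun u => ?_
          rw [lintegral_const_mul _ (by fun_prop)]
  have hlim : Tendsto (fun n => ∫⁻ u : Vec p, ‖productKernel k u‖ₑ * ω (h n • u)) atTop
      (𝓝 (∫⁻ _ : Vec p, 0)) := by
    refine tendsto_lintegral_of_dominated_convergence
      (fun u => ‖productKernel k u‖ₑ * (2 * ∫⁻ x, ‖F x‖ₑ)) ?_ ?_ ?_ ?_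
    · intro n; fun_prop
    · exact fun n => ae_of_all _ fun u => mul_le_mul_right (hωb _) _
    · rw [lintegral_mul_const _ (by fun_prop)]
      exact ENNReal.mul_ne_top hk.2.ne (ENNReal.mul_ne_top (by simp) hFfin)
    · refine ae_of_all _ fun u => ?_
      have h1 : Tendsto (fun n => h n • u) atTop (𝓝 0) := by
        simpa using hh.smul_const u
      have h2 := (tendsto_lintegral_translate_sub hF).comp h1
      simpa using ENNReal.Tendsto.const_mul h2 (Or.inr (enorm_ne_top (x := productKernel k u)))
  rw [lintegral_zero] at hlim
  exact tendsto_of_tendsto_of_tendsto_of_le_of_le tendsto_const_nhds hlim (fun _ => bot_le) key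

/-! ### Consequences of the bandwidth condition -/

namespace BandwidthCondition

variable {h : ℕ → ℝ}

lemma tendsto_inv (hb : BandwidthCondition p h) :
    Tendsto (fun n : ℕ => ((n : ℝ) * h n ^ p)⁻¹) atTop (𝓝 0) := by
  obtain ⟨hpos, δ, -, ht⟩ := hb
  refine tendsto_of_tendsto_of_tendsto_of_le_of_le tendsto_const_nhds ht ?_ ?_
  · intro n; have := hpos n; positivity
  · intro n
    have := hpos n
    have : 0 ≤ (n : ℝ) * h n ^ ((p : ℝ) + δ) := by positivity
    simpa using this

/-- For $n\ge1$ one has $h^{p+\delta}\le nh^{p+\delta}$, and the exponent is positive even for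
$p=0$, so a root can be taken. -/
lemma tendsto_zero (hb : BandwidthCondition p h) : Tendsto h atTop (𝓝 0) := by
  obtain ⟨hpos, δ, hδ, ht⟩ := hb
  have h1 : Tendsto (fun n : ℕ => h n ^ ((p : ℝ) + δ)) atTop (𝓝 0) := by
    refine tendsto_of_tendsto_of_tendsto_of_le_of_le' tendsto_const_nhds ht ?_ ?_
    · exact Eventually.of_forall fun n => (Real.rpow_pos_of_pos (hpos n) _).le
    · filter_upwards [eventually_ge_atTop 1] with n hn
      have h0 := hpos n
      have h2 : 0 < h n ^ ((p : ℝ) + δ) := Real.rpow_pos_of_pos h0 _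
      have h3 : (1 : ℝ) ≤ n := by exact_mod_cast hn
      have h4 : 0 ≤ ((n : ℝ) * h n ^ p)⁻¹ := by positivity
      nlinarith
  have hpd : 0 < (p : ℝ) + δ := by positivity
  have h2 := h1.rpow_const (p := ((p : ℝ) + δ)⁻¹) (Or.inr (by positivity))
  rw [Real.zero_rpow (inv_ne_zero hpd.ne')] at h2
  refine h2.congr fun n => ?_
  rw [← Real.rpow_mul (hpos n).le, mul_inv_cancel₀ hpd.ne', Real.rpow_one]

end BandwidthCondition

/-! ### Second moments of averages of conditionally centred kernels -/

section Pairs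

variable {Ω E : Type*} [MeasurableSpace Ω] [MeasurableSpace E] {μ : Measure Ω}
  [IsProbabilityMeasure μ] {P : Measure E} [IsProbabilityMeasure P] {Z : ℕ → Ω → E}

lemma map_pair_eq_prod (hZ : ∀ j, Measurable (Z j)) (hind : iIndepFun Z μ)
    (hlaw : ∀ j, μ.map (Z j) = P) {j v : ℕ} (hjv : j ≠ v) :
    μ.map (fun ω => (Z j ω, Z v ω)) = P.prod P := by
  have := (indepFun_iff_map_prod_eq_prod_map_map (hZ j).aemeasurable (hZ v).aemeasurable).1
    (hind.indepFun hjv)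
  rwa [hlaw, hlaw] at this

/-- The bracketing lets Fubini integrate over the third variable with the first two fixed. -/
lemma map_triple_eq_prod (hZ : ∀ j, Measurable (Z j)) (hind : iIndepFun Z μ)
    (hlaw : ∀ j, μ.map (Z j) = P) {j v w : ℕ} (hjv : j ≠ v) (hjw : j ≠ w) (hvw : v ≠ w) :
    μ.map (fun ω => ((Z j ω, Z v ω), Z w ω)) = (P.prod P).prod P := by
  have := (indepFun_iff_map_prod_eq_prod_map_map ((hZ j).prodMk (hZ v)).aemeasurable
    (hZ w).aemeasurable).1 (hind.indepFun_prodMk hZ j v w hjw hvw)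
  rwa [hlaw, map_pair_eq_prod hZ hind hlaw hjv] at this

variable {r : E × E → ℝ}

/-- A conditionally centred kernel gives uncorrelated summands. -/
lemma integral_mul_eq_zero_of_centred (hZ : ∀ j, Measurable (Z j)) (hind : iIndepFun Z μ)
    (hlaw : ∀ j, μ.map (Z j) = P) (hr : Measurable r) {B : ℝ} (hB : ∀ z, |r z| ≤ B)
    (hc : ∀ z, ∫ z', r (z, z') ∂P = 0) {j v w : ℕ} (hjv : j ≠ v) (hjw : j ≠ w) (hvw : v ≠ w) :
    ∫ ω, r (Z j ω, Z v ω) * r (Z j ω, Z w ω) ∂μ = 0 := by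
  have h1 : Measurable fun z : (E × E) × E => r z.1 * r (z.1.1, z.2) := by fun_prop
  have h2 : ∫ ω, r (Z j ω, Z v ω) * r (Z j ω, Z w ω) ∂μ
      = ∫ z, r z.1 * r (z.1.1, z.2) ∂((P.prod P).prod P) := by
    rw [← map_triple_eq_prod hZ hind hlaw hjv hjw hvw, integral_map _ h1.aestronglyMeasurable]
    exact (((hZ j).prodMk (hZ v)).prodMk (hZ w)).aemeasurable
  -- With $Z_j,Z_v$ fixed, the first factor is constant and the integral of the second over $Z_w$
  -- vanishes.
  rw [h2, integral_prod]
  · simp [integral_const_mul, hc]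
  · refine Integrable.of_bound h1.aestronglyMeasurable (B * B) (ae_of_all _ fun z => ?_)
    rw [norm_mul]
    exact mul_le_mul (hB _) (hB _) (norm_nonneg _) ((abs_nonneg _).trans (hB z.1))

/-- Off-diagonal products have mean zero, so the second moment grows like the number of summands and
not like its square. The index $j$ is excluded because $r(Z_j,Z_j)$ is not centred. -/
lemma integral_sq_sum_of_centred (hZ : ∀ j, Measurable (Z j)) (hind : iIndepFun Z μ)
    (hlaw : ∀ j, μ.map (Z j) = P) (hr : Measurable r) {B : ℝ} (hB : ∀ z, |r z| ≤ B)
    (hc : ∀ z, ∫ z', r (z, z') ∂P = 0) {j : ℕ} {S : Finset ℕ} (hS : j ∉ S) :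
    ∫ ω, (∑ v ∈ S, r (Z j ω, Z v ω)) ^ 2 ∂μ = S.card * ∫ z, r z ^ 2 ∂(P.prod P) := by
  have hint : ∀ v w, Integrable (fun ω => r (Z j ω, Z v ω) * r (Z j ω, Z w ω)) μ := by
    intro v w
    have := hZ j; have := hZ v; have := hZ w
    refine Integrable.of_bound (Measurable.aestronglyMeasurable (by fun_prop)) (B * B)
      (ae_of_all _ fun ω => ?_)
    rw [norm_mul]
    exact mul_le_mul (hB _) (hB _) (norm_nonneg _) ((abs_nonneg _).trans (hB (Z j ω, Z v ω)))
  have hne : ∀ v ∈ S, j ≠ v := fun v hv h => hS (h ▸ hv)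
  have hdiag : ∀ v ∈ S, ∫ ω, r (Z j ω, Z v ω) * r (Z j ω, Z v ω) ∂μ
      = ∫ z, r z ^ 2 ∂(P.prod P) := by
    intro v hv
    rw [← map_pair_eq_prod hZ hind hlaw (hne v hv),
      integral_map ((hZ j).prodMk (hZ v)).aemeasurable (by fun_prop)]
    simp only [sq]
  simp only [sq (Finset.sum _ _), Finset.sum_mul_sum]
  rw [integral_finsetSum _ fun v _ => integrable_finsetSum _ fun w _ => hint v w]
  have : ∀ v ∈ S, ∫ ω, ∑ w ∈ S, r (Z j ω, Z v ω) * r (Z j ω, Z w ω) ∂μ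
      = ∫ z, r z ^ 2 ∂(P.prod P) := by
    intro v hv
    rw [integral_finsetSum _ fun w _ => hint v w, Finset.sum_eq_single_of_mem v hv, hdiag v hv]
    intro w hw hwv
    exact integral_mul_eq_zero_of_centred hZ hind hlaw hr hB hc (hne v hv) (hne w hw) hwv.symm
  rw [Finset.sum_congr rfl this, Finset.sum_const, nsmul_eq_mul]

/-- Chebyshev-type `L¹` bound for averages of a conditionally centred kernel. -/
lemma lintegral_average_le_of_centred (hZ : ∀ j, Measurable (Z j)) (hind : iIndepFun Z μ)
    (hlaw : ∀ j, μ.map (Z j) = P) (hr : Measurable r) {B : ℝ} (hB : ∀ z, |r z| ≤ B)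
    (hc : ∀ z, ∫ z', r (z, z') ∂P = 0) {j n : ℕ} (hj : j < n) {η V : ℝ} (hη : 0 < η)
    (hV : ∫ z, r z ^ 2 ∂(P.prod P) ≤ V) :
    ∫⁻ ω, ‖(n : ℝ)⁻¹ * ∑ v ∈ Finset.range n, r (Z j ω, Z v ω)‖ₑ ∂μ
      ≤ ENNReal.ofReal (B / n + η + V / (n * η)) := by
  have hn : (0 : ℝ) < n := by exact_mod_cast (Nat.zero_le j).trans_lt hj
  -- The term $v=j$ is split off; it contributes at most $B/n$.
  set S := (Finset.range n).erase j
  have hZj := hZ j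
  have hsum : Measurable fun ω => ∑ v ∈ S, r (Z j ω, Z v ω) := by
    refine Finset.measurable_sum _ fun v _ => ?_
    have := hZ v
    fun_prop
  have hsumB : ∀ ω, |∑ v ∈ S, r (Z j ω, Z v ω)| ≤ S.card * B := fun ω =>
    (Finset.abs_sum_le_sum_abs _ _).trans
      ((Finset.sum_le_sum fun v _ => hB _).trans (by simp))
  have hmeas : Measurable fun ω => (n : ℝ)⁻¹ * ∑ v ∈ Finset.range n, r (Z j ω, Z v ω) := by
    refine (Finset.measurable_sum _ fun v _ => ?_).const_mul _
    have := hZ v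
    fun_prop
  have hsqint : Integrable (fun ω => (∑ v ∈ S, r (Z j ω, Z v ω)) ^ 2) μ := by
    refine Integrable.of_bound (hsum.pow_const 2).aestronglyMeasurable ((S.card * B) ^ 2)
      (ae_of_all _ fun ω => ?_)
    rw [norm_pow]
    exact pow_le_pow_left₀ (norm_nonneg _) (hsumB ω) 2
  have hpt : ∀ ω, ‖(n : ℝ)⁻¹ * ∑ v ∈ Finset.range n, r (Z j ω, Z v ω)‖
      ≤ B / n + η + (n ^ 2 * η)⁻¹ * (∑ v ∈ S, r (Z j ω, Z v ω)) ^ 2 := by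
    intro ω
    rw [← Finset.add_sum_erase _ _ (Finset.mem_range.2 hj)]
    set s := ∑ v ∈ S, r (Z j ω, Z v ω) with hs
    have h1 := hB (Z j ω, Z j ω)
    rw [Real.norm_eq_abs, abs_mul, abs_of_pos (inv_pos.2 hn)]
    have h2 : |r (Z j ω, Z j ω) + s| ≤ B + |s| := (abs_add_le _ _).trans (by linarith)
    -- The inequality $t\le\eta+t^2/\eta$ turns the second moment bound into an $L^1$ bound.
    have h3 : (n : ℝ)⁻¹ * |s| ≤ η + (n ^ 2 * η)⁻¹ * s ^ 2 := by
      have : (n ^ 2 * η)⁻¹ * s ^ 2 = ((n : ℝ)⁻¹ * |s|) ^ 2 / η := by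
        rw [mul_pow, sq_abs]; field_simp
      rw [this]
      set t := (n : ℝ)⁻¹ * |s|
      have : t ^ 2 / η + η - t = ((t - η / 2) ^ 2 + 3 / 4 * η ^ 2) / η := by field_simp; ring
      have : 0 ≤ ((t - η / 2) ^ 2 + 3 / 4 * η ^ 2) / η := by positivity
      linarith
    calc (n : ℝ)⁻¹ * |r (Z j ω, Z j ω) + s| ≤ (n : ℝ)⁻¹ * (B + |s|) := by gcongr
      _ = B / n + (n : ℝ)⁻¹ * |s| := by ring
      _ ≤ _ := by linarith
  have hbint : Integrable (fun ω => B / n + η + (n ^ 2 * η)⁻¹ * (∑ v ∈ S, r (Z j ω, Z v ω)) ^ 2) μ :=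
    (integrable_const _).add (hsqint.const_mul _)
  have hint := hbint.mono' hmeas.aestronglyMeasurable (ae_of_all _ hpt)
  rw [← ofReal_integral_norm_eq_lintegral_enorm hint]
  refine ENNReal.ofReal_le_ofReal ((integral_mono hint.norm hbint hpt).trans ?_)
  rw [integral_add (integrable_const _) (hsqint.const_mul _), integral_const_mul,
    integral_sq_sum_of_centred hZ hind hlaw hr hB hc (Finset.notMem_erase j _)]
  have hcard : (S.card : ℝ) ≤ n := by
    have : S.card ≤ n := (Finset.card_erase_le).trans (by simp)
    exact_mod_cast this
  have hI : 0 ≤ ∫ z, r z ^ 2 ∂(P.prod P) := integral_nonneg fun _ => sq_nonneg _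
  have : (n ^ 2 * η)⁻¹ * (S.card * ∫ z, r z ^ 2 ∂(P.prod P)) ≤ (n ^ 2 * η)⁻¹ * (n * V) := by
    gcongr
  have h4 : ((n : ℝ) ^ 2 * η)⁻¹ * (n * V) = V / (n * η) := by field_simp
  simp only [integral_const, probReal_univ, one_smul]
  linarith

end Pairs

/-! ### $L^1$ bounds for kernel averages -/

section KernelAverages

variable {Ω : Type*} [MeasurableSpace Ω] {μ : Measure Ω} [IsProbabilityMeasure μ] {p : ℕ}
  {P : Measure (ℝ × Vec p)} [IsProbabilityMeasure P] {Z : ℕ → Ω → ℝ × Vec p}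
  {κ : Vec p → ℝ} {g : ℝ × Vec p → ℝ} {C : ℝ≥0∞}

/-- A form of Young's inequality: the first covariate is integrated out first, its law is dominated
by $C$ times Lebesgue measure, and translation invariance removes the dependence on the second
point. -/
lemma lintegral_prod_kernel_le (hC : P.map Prod.snd ≤ C • volume) (hκ : Measurable κ)
    (hg : Measurable g) :
    ∫⁻ z, ‖κ (z.1.2 - z.2.2)‖ₑ * ‖g z.2‖ₑ ∂(P.prod P)
      ≤ C * (∫⁻ u, ‖κ u‖ₑ) * ∫⁻ z, ‖g z‖ₑ ∂P := by
  rw [lintegral_prod_symm _ (by fun_prop)]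
  calc _ ≤ ∫⁻ z, C * (∫⁻ u, ‖κ u‖ₑ) * ‖g z‖ₑ ∂P := by
        refine lintegral_mono fun z => ?_
        simp only
        rw [lintegral_mul_const _ (by fun_prop)]
        refine mul_le_mul_left ?_ _
        rw [← lintegral_map (f := fun x => ‖κ (x - z.2)‖ₑ) (by fun_prop) measurable_snd]
        refine (lintegral_mono' hC le_rfl).trans ?_
        rw [lintegral_smul_measure, lintegral_sub_right_eq_self (fun x => ‖κ x‖ₑ) z.2, smul_eq_mul]
    _ = _ := lintegral_const_mul _ hg.enorm

lemma lintegral_kernel_pair_le (hZ : ∀ j, Measurable (Z j)) (hind : iIndepFun Z μ)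
    (hlaw : ∀ j, μ.map (Z j) = P) (hC : P.map Prod.snd ≤ C • volume) (hκ : Measurable κ)
    (hg : Measurable g) {j v : ℕ} (hjv : j ≠ v) :
    ∫⁻ ω, ‖κ ((Z j ω).2 - (Z v ω).2)‖ₑ * ‖g (Z v ω)‖ₑ ∂μ
      ≤ C * (∫⁻ u, ‖κ u‖ₑ) * ∫⁻ z, ‖g z‖ₑ ∂P := by
  refine le_trans (le_of_eq ?_) (lintegral_prod_kernel_le hC hκ hg)
  rw [← map_pair_eq_prod hZ hind hlaw hjv, lintegral_map (by fun_prop) ((hZ j).prodMk (hZ v))]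

/-- Averages of `|κ(X_j - X_v) g(Z_v)|` are bounded in `L¹`. -/
lemma lintegral_kernel_average_le (hZ : ∀ j, Measurable (Z j)) (hind : iIndepFun Z μ)
    (hlaw : ∀ j, μ.map (Z j) = P) (hC : P.map Prod.snd ≤ C • volume) (hκ : Measurable κ)
    (hg : Measurable g) {B : ℝ} (hB : ∀ u, |κ u| ≤ B) {j n : ℕ} (hj : j < n) :
    ∫⁻ ω, ‖(n : ℝ)⁻¹ * ∑ v ∈ Finset.range n, |κ ((Z j ω).2 - (Z v ω).2) * g (Z v ω)|‖ₑ ∂μ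
      ≤ (C * (∫⁻ u, ‖κ u‖ₑ) + ENNReal.ofReal (B / n)) * ∫⁻ z, ‖g z‖ₑ ∂P := by
  have hn0 : n ≠ 0 := by omega
  have hn : (0 : ℝ) < n := by positivity
  have hB0 : 0 ≤ B := (abs_nonneg _).trans (hB 0)
  have hninv : ‖(n : ℝ)⁻¹‖ₑ = (n : ℝ≥0∞)⁻¹ := by
    rw [Real.enorm_eq_ofReal (by positivity), ENNReal.ofReal_inv_of_pos hn, ENNReal.ofReal_natCast]
  -- On the diagonal the argument of $\kappa$ is not random, so only the supremum bound $B$ applies;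
  -- after division by $n$ it gives the term $B/n$.
  have hdiag : ∫⁻ ω, ‖κ ((Z j ω).2 - (Z j ω).2)‖ₑ * ‖g (Z j ω)‖ₑ ∂μ
      ≤ ENNReal.ofReal B * ∫⁻ z, ‖g z‖ₑ ∂P := by
    rw [← hlaw j, lintegral_map hg.enorm (hZ j), ← lintegral_const_mul _ (by have := hZ j; fun_prop)]
    refine lintegral_mono fun ω => mul_le_mul_left ?_ _
    rw [Real.enorm_eq_ofReal_abs]
    exact ENNReal.ofReal_le_ofReal (hB _)
  calc _ ≤ ∫⁻ ω, (n : ℝ≥0∞)⁻¹ * ∑ v ∈ Finset.range n,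
        ‖κ ((Z j ω).2 - (Z v ω).2)‖ₑ * ‖g (Z v ω)‖ₑ ∂μ := by
        refine lintegral_mono fun ω => ?_
        rw [enorm_mul, hninv]
        refine mul_le_mul_right ((enorm_sum_le _ _).trans (Finset.sum_le_sum fun v _ => ?_)) _
        rw [← enorm_mul, Real.enorm_abs]
    _ = (n : ℝ≥0∞)⁻¹ * ∑ v ∈ Finset.range n,
        ∫⁻ ω, ‖κ ((Z j ω).2 - (Z v ω).2)‖ₑ * ‖g (Z v ω)‖ₑ ∂μ := by
        have hm : ∀ v, Measurable fun ω => ‖κ ((Z j ω).2 - (Z v ω).2)‖ₑ * ‖g (Z v ω)‖ₑ := by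
          intro v
          have := hZ j; have := hZ v
          fun_prop
        rw [lintegral_const_mul _ (Finset.measurable_sum _ fun v _ => hm v),
          lintegral_finsetSum _ fun v _ => hm v]
    _ ≤ (n : ℝ≥0∞)⁻¹ * (ENNReal.ofReal B * ∫⁻ z, ‖g z‖ₑ ∂P +
          n * (C * (∫⁻ u, ‖κ u‖ₑ) * ∫⁻ z, ‖g z‖ₑ ∂P)) := by
        refine mul_le_mul_right ?_ _
        rw [← Finset.add_sum_erase _ _ (Finset.mem_range.2 hj)]
        refine add_le_add hdiag ((Finset.sum_le_card_nsmul _ _ _ fun v hv =>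
          lintegral_kernel_pair_le hZ hind hlaw hC hκ hg (Finset.ne_of_mem_erase hv).symm).trans ?_)
        rw [nsmul_eq_mul]
        refine mul_le_mul_left ?_ _
        exact_mod_cast (Finset.card_erase_le).trans (by simp)
    _ = _ := by
        rw [mul_add, ← mul_assoc _ (n : ℝ≥0∞), ENNReal.inv_mul_cancel (by exact_mod_cast hn0)
          (ENNReal.natCast_ne_top n), one_mul, ENNReal.ofReal_div_of_pos hn,
          ENNReal.ofReal_natCast, div_eq_mul_inv, add_mul, add_comm]
        ring

lemma enorm_average_le_average_abs (n : ℕ) (a : ℕ → ℝ) :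
    ‖(n : ℝ)⁻¹ * ∑ v ∈ Finset.range n, a v‖ₑ ≤ ‖(n : ℝ)⁻¹ * ∑ v ∈ Finset.range n, |a v|‖ₑ := by
  rw [enorm_mul, enorm_mul]
  refine mul_le_mul_right ?_ _
  rw [Real.enorm_eq_ofReal_abs, Real.enorm_eq_ofReal (Finset.sum_nonneg fun _ _ => abs_nonneg _)]
  exact ENNReal.ofReal_le_ofReal (Finset.abs_sum_le_sum_abs _ _)

end KernelAverages

/-! ### $L^1$ consistency of kernel averages at the design points -/

section KernelLimits

variable {Ω : Type*} [MeasurableSpace Ω] {μ : Measure Ω} [IsProbabilityMeasure μ] {p : ℕ}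
  {P : Measure (ℝ × Vec p)} [IsProbabilityMeasure P] {Z : ℕ → Ω → ℝ × Vec p}
  {κ : Vec p → ℝ} {g : ℝ × Vec p → ℝ} {C : ℝ≥0∞}

/-- The expectation of a kernel average at the point `x`. -/
def kernelMean (P : Measure (ℝ × Vec p)) (κ : Vec p → ℝ) (g : ℝ × Vec p → ℝ) (x : Vec p) : ℝ :=
  ∫ z, κ (x - z.2) * g z ∂P

lemma measurable_kernelMean (hκ : Measurable κ) (hg : Measurable g) :
    Measurable (kernelMean P κ g) := by
  refine StronglyMeasurable.measurable (StronglyMeasurable.integral_prod_right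
    (f := fun (x : Vec p) (z : ℝ × Vec p) => κ (x - z.2) * g z) ?_)
  refine Measurable.stronglyMeasurable ?_
  unfold Function.uncurry
  fun_prop

lemma lintegral_kernelMean_le (hC : P.map Prod.snd ≤ C • volume) (hκ : Measurable κ)
    (hg : Measurable g) :
    ∫⁻ z, ‖kernelMean P κ g z.2‖ₑ ∂P ≤ C * (∫⁻ u, ‖κ u‖ₑ) * ∫⁻ z, ‖g z‖ₑ ∂P := by
  refine le_trans ?_ (lintegral_prod_kernel_le hC hκ hg)
  rw [lintegral_prod _ (by fun_prop)]
  refine lintegral_mono fun z => (enorm_integral_le_lintegral_enorm _).trans (le_of_eq ?_)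
  simp only [enorm_mul]

/-- `L¹` bound on the stochastic part of a kernel average of a bounded function. -/
lemma lintegral_bounded_average_sub_le (hZ : ∀ j, Measurable (Z j)) (hind : iIndepFun Z μ)
    (hlaw : ∀ j, μ.map (Z j) = P) (hC : P.map Prod.snd ≤ C • volume) (hκ : Measurable κ)
    (hg : Measurable g) {A B Q η : ℝ} (hA : ∀ z, |g z| ≤ A) (hB : ∀ u, |κ u| ≤ B)
    (hQ0 : 0 ≤ Q) (hQ : C * (∫⁻ u, ‖κ u‖ₑ) * ∫⁻ z, ‖g z‖ₑ ∂P ≤ ENNReal.ofReal Q) (hη : 0 < η)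
    {j n : ℕ} (hj : j < n) :
    ∫⁻ ω, ‖(n : ℝ)⁻¹ * ∑ v ∈ Finset.range n,
        (κ ((Z j ω).2 - (Z v ω).2) * g (Z v ω) - kernelMean P κ g (Z j ω).2)‖ₑ ∂μ
      ≤ ENNReal.ofReal (2 * B * A / n + η + 4 * B * A * Q / (n * η)) := by
  have hB0 : 0 ≤ B := (abs_nonneg _).trans (hB 0)
  have hA0 : 0 ≤ A := (abs_nonneg _).trans (hA 0)
  have hmb := measurable_kernelMean (P := P) hκ hg
  have hqB : ∀ x z, |κ (x - z.2) * g z| ≤ B * A := fun x z => by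
    rw [abs_mul]; exact mul_le_mul (hB _) (hA _) (abs_nonneg _) hB0
  have hbB : ∀ x, |kernelMean P κ g x| ≤ B * A := fun x => by
    have := norm_integral_le_of_norm_le_const (μ := P) (f := fun z => κ (x - z.2) * g z)
      (C := B * A) (ae_of_all _ fun z => hqB x z)
    simpa [kernelMean] using this
  set r : (ℝ × Vec p) × (ℝ × Vec p) → ℝ := fun z =>
    κ (z.1.2 - z.2.2) * g z.2 - kernelMean P κ g z.1.2 with hr
  have hrm : Measurable r := by fun_prop
  have hrB : ∀ z, |r z| ≤ 2 * B * A := fun z => by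
    refine (abs_sub _ _).trans ?_
    linarith [hqB z.1.2 z.2, hbB z.1.2]
  have hqint : ∀ x, Integrable (fun z => κ (x - z.2) * g z) P := fun x =>
    Integrable.of_bound (Measurable.aestronglyMeasurable (by fun_prop)) (B * A)
      (ae_of_all _ fun z => hqB x z)
  refine lintegral_average_le_of_centred (r := r) hZ hind hlaw hrm hrB ?_ hj hη ?_
  · intro z
    simp only [hr]
    rw [integral_sub (hqint _) (integrable_const _)]
    simp [kernelMean]
  · have hrint : Integrable r (P.prod P) :=
      Integrable.of_bound hrm.aestronglyMeasurable _ (ae_of_all _ hrB)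
    -- Bounding $r^2$ by $2BA|r|$ makes the second moment linear in $B$. This matters because $B$ is
    -- of order $h^{-p}$: only $B/n\to0$ is available, not $B^2/n\to0$.
    have h1 : ∫ z, |r z| ∂(P.prod P) ≤ 2 * Q := by
      rw [← ENNReal.ofReal_le_ofReal_iff (by positivity)]
      have := ofReal_integral_norm_eq_lintegral_enorm hrint
      simp only [Real.norm_eq_abs] at this
      rw [this]
      calc ∫⁻ z, ‖r z‖ₑ ∂(P.prod P)
          ≤ ∫⁻ z, (‖κ (z.1.2 - z.2.2)‖ₑ * ‖g z.2‖ₑ + ‖kernelMean P κ g z.1.2‖ₑ) ∂(P.prod P) := by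
            refine lintegral_mono fun z => ?_
            rw [← enorm_mul]
            exact enorm_sub_le
        _ = ∫⁻ z, ‖κ (z.1.2 - z.2.2)‖ₑ * ‖g z.2‖ₑ ∂(P.prod P)
            + ∫⁻ z, ‖kernelMean P κ g z.2‖ₑ ∂P := by
            rw [lintegral_add_right _ (by fun_prop)]
            congr 1
            rw [lintegral_prod _ (by fun_prop)]
            simp
        _ ≤ ENNReal.ofReal Q + ENNReal.ofReal Q :=
            add_le_add ((lintegral_prod_kernel_le hC hκ hg).trans hQ)
              ((lintegral_kernelMean_le hC hκ hg).trans hQ)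
        _ = _ := by rw [← ENNReal.ofReal_add hQ0 hQ0, two_mul]
    calc ∫ z, r z ^ 2 ∂(P.prod P) ≤ ∫ z, 2 * B * A * |r z| ∂(P.prod P) := by
          refine integral_mono ?_ (hrint.abs.const_mul _) fun z => ?_
          · refine Integrable.of_bound (hrm.pow_const 2).aestronglyMeasurable ((2 * B * A) ^ 2)
              (ae_of_all _ fun z => ?_)
            rw [norm_pow]
            exact pow_le_pow_left₀ (norm_nonneg _) (hrB z) 2
          · simp only
            rw [← sq_abs, sq]
            exact mul_le_mul_of_nonneg_right (hrB z) (abs_nonneg _)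
      _ = 2 * B * A * ∫ z, |r z| ∂(P.prod P) := integral_const_mul _ _
      _ ≤ 2 * B * A * (2 * Q) := by gcongr
      _ = _ := by ring

/-- `L¹` consistency of kernel averages at the design points. Here `F` is the density of the
measure `B ↦ E[g(Z); X ∈ B]`. -/
theorem eventually_lintegral_kernel_average_sub_le (hZ : ∀ j, Measurable (Z j))
    (hind : iIndepFun Z μ) (hlaw : ∀ j, μ.map (Z j) = P) (hC : P.map Prod.snd ≤ C • volume)
    (hCfin : C ≠ ∞) {k : ℝ → ℝ} {h : ℕ → ℝ} (hkernel : KernelCondition p k)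
    (hband : BandwidthCondition p h) (hg : Measurable g) (hgint : Integrable g P) {F : Vec p → ℝ}
    (hF : Measurable F) (hFint : Integrable F)
    (hgF : ∀ φ : Vec p → ℝ, Measurable φ → (∃ b, ∀ x, |φ x| ≤ b) →
      ∫ z, φ z.2 * g z ∂P = ∫ x, φ x * F x) {ε : ℝ≥0∞} (hε : 0 < ε) :
    ∀ᶠ n : ℕ in atTop, ∀ j < n, ∫⁻ ω, ‖(n : ℝ)⁻¹ * ∑ v ∈ Finset.range n,
        scaledKernel k (h n) ((Z j ω).2 - (Z v ω).2) * g (Z v ω) - F (Z j ω).2‖ₑ ∂μ ≤ ε := by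
  obtain ⟨M, hM0, hM⟩ := hkernel.exists_bound_productKernel
  have hKm := hkernel.measurable_productKernel
  have hKi := hkernel.integrable_productKernel
  have hpos := hband.1
  set L : ℝ≥0∞ := ∫⁻ u : Vec p, ‖productKernel k u‖ₑ with hL
  have hLfin : L ≠ ∞ := hKi.2.ne
  -- The factor covers the four errors below, $CL+1$, $2$, $CL$ and $C$ times $\delta$, with one
  -- $\delta$ to spare.
  obtain ⟨δ, hδ0, hδ⟩ : ∃ δ : ℝ, 0 < δ ∧ (2 * (C * L) + C + 4) * ENNReal.ofReal δ ≤ ε := by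
    have hc : (2 * (C * L) + C + 4) ≠ ∞ := by finiteness
    have h1 : Tendsto (fun δ : ℝ => (2 * (C * L) + C + 4) * ENNReal.ofReal δ) (𝓝[>] 0) (𝓝 0) := by
      have h2 : Tendsto (fun δ : ℝ => ENNReal.ofReal δ) (𝓝[>] 0) (𝓝 0) := by
        have := (ENNReal.continuous_ofReal.tendsto 0).mono_left
          (nhdsWithin_le_nhds (s := Set.Ioi (0 : ℝ)))
        simpa using this
      simpa using ENNReal.Tendsto.const_mul h2 (Or.inr hc)
    obtain ⟨δ, h3, h4⟩ := ((h1.eventually_le_const hε).and self_mem_nhdsWithin).exists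
    exact ⟨δ, h4, h3⟩
  -- Second moments of $g$ need not exist, so Chebyshev is applied to a bounded $g_1$ close to $g$
  -- in $L^1$.
  obtain ⟨g₁, hg₁, -⟩ := (memLp_one_iff_integrable.2 hgint).exists_simpleFunc_eLpNorm_sub_lt
    (by simp) (ENNReal.ofReal_pos.2 hδ0).ne'
  rw [eLpNorm_one_eq_lintegral_enorm] at hg₁
  have hg₁m : Measurable g₁ := g₁.measurable
  obtain ⟨A, hA⟩ := g₁.exists_forall_norm_le
  have hA0 : 0 ≤ A := (norm_nonneg _).trans (hA 0)
  have hg₁int : Integrable g₁ P :=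
    Integrable.of_bound hg₁m.aestronglyMeasurable A (ae_of_all _ hA)
  set Q : ℝ := (C * L * ∫⁻ z, ‖g₁ z‖ₑ ∂P).toReal with hQ
  have hQ0 : 0 ≤ Q := ENNReal.toReal_nonneg
  have hQle : C * L * ∫⁻ z, ‖g₁ z‖ₑ ∂P ≤ ENNReal.ofReal Q := by
    rw [hQ, ENNReal.ofReal_toReal]
    have := hg₁int.2.ne
    finiteness
  have hinv := hband.tendsto_inv
  have hlimA : Tendsto (fun n : ℕ => M * ((n : ℝ) * h n ^ p)⁻¹) atTop (𝓝 0) := by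
    simpa using hinv.const_mul M
  have hlimB : Tendsto (fun n : ℕ => (2 * A + 4 * A * Q / δ) * (M * ((n : ℝ) * h n ^ p)⁻¹))
      atTop (𝓝 0) := by
    simpa using hlimA.const_mul (2 * A + 4 * A * Q / δ)
  have hbias := tendsto_lintegral_scaledKernel_conv_sub hKm hKi hkernel.integral_productKernel
    hpos hband.tendsto_zero hF hFint
  filter_upwards [hlimA.eventually_le_const (zero_lt_one), hlimB.eventually_le_const hδ0,
    hbias.eventually_le_const (ENNReal.ofReal_pos.2 hδ0)] with n hn1 hn2 hn3 j hj
  set κ := scaledKernel (p := p) k (h n) with hκdef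
  have hκ : Measurable κ := measurable_scaledKernel hKm _
  have hκL : ∫⁻ u, ‖κ u‖ₑ = L := lintegral_scaledKernel hKi (hpos n)
  have hhp : 0 < h n ^ p := pow_pos (hpos n) p
  have hκB : ∀ u, |κ u| ≤ (h n ^ p)⁻¹ * M := fun u => by
    rw [hκdef, scaledKernel, abs_mul, abs_of_pos (inv_pos.2 hhp)]
    exact mul_le_mul_of_nonneg_left (hM _) (by positivity)
  have hn0 : n ≠ 0 := by omega
  have hBn : (h n ^ p)⁻¹ * M / n = M * ((n : ℝ) * h n ^ p)⁻¹ := by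
    rw [mul_inv]; ring
  have hκint : ∀ (g' : ℝ × Vec p → ℝ), Integrable g' P → ∀ x,
      Integrable (fun z => κ (x - z.2) * g' z) P := fun g' hg' x =>
    hg'.bdd_mul (c := (h n ^ p)⁻¹ * M) (Measurable.aestronglyMeasurable (by fun_prop))
      (ae_of_all _ fun z => hκB _)
  -- The expected kernel average is the convolution of $\kappa$ with $F$, so its error is the
  -- approximate identity error.
  have hconv : ∀ x, kernelMean P κ g x = ∫ a, κ (x - a) * F a := fun x =>
    hgF (fun a => κ (x - a)) (by fun_prop) ⟨_, fun a => hκB _⟩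
  have hmean : ∀ x, kernelMean P κ g₁ x - kernelMean P κ g x
      = kernelMean P κ (fun z => g₁ z - g z) x := fun x => by
    simp only [kernelMean, mul_sub]
    rw [integral_sub (hκint _ hg₁int x) (hκint _ hgint x)]
  -- Approximation error in the average, centred average of $g_1$, approximation error in the mean,
  -- and bias.
  have hdecomp : ∀ ω, (n : ℝ)⁻¹ * ∑ v ∈ Finset.range n,
        κ ((Z j ω).2 - (Z v ω).2) * g (Z v ω) - F (Z j ω).2
      = (n : ℝ)⁻¹ * ∑ v ∈ Finset.range n, κ ((Z j ω).2 - (Z v ω).2) * (g (Z v ω) - g₁ (Z v ω))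
        + (n : ℝ)⁻¹ * ∑ v ∈ Finset.range n,
          (κ ((Z j ω).2 - (Z v ω).2) * g₁ (Z v ω) - kernelMean P κ g₁ (Z j ω).2)
        + kernelMean P κ (fun z => g₁ z - g z) (Z j ω).2
        + ((∫ a, κ ((Z j ω).2 - a) * F a) - F (Z j ω).2) := by
    intro ω
    rw [← hconv, ← hmean, Finset.sum_sub_distrib, Finset.sum_const, Finset.card_range,
      nsmul_eq_mul]
    simp only [mul_sub, Finset.sum_sub_distrib]
    rw [inv_mul_cancel_left₀ (by exact_mod_cast hn0)]
    ring
  have hm₁ := measurable_kernelMean (P := P) hκ hg₁m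
  have hm₂ := measurable_kernelMean (P := P) hκ (hg₁m.sub hg)
  have hm₃ := measurable_kernelMean (P := P) hκ hg
  have hZj := hZ j
  have hZm : ∀ v, Measurable fun ω => κ ((Z j ω).2 - (Z v ω).2) := fun v => by
    have := hZ v; fun_prop
  calc _ ≤ ∫⁻ ω, (‖(n : ℝ)⁻¹ * ∑ v ∈ Finset.range n,
            |κ ((Z j ω).2 - (Z v ω).2) * (g (Z v ω) - g₁ (Z v ω))|‖ₑ
        + ‖(n : ℝ)⁻¹ * ∑ v ∈ Finset.range n,
          (κ ((Z j ω).2 - (Z v ω).2) * g₁ (Z v ω) - kernelMean P κ g₁ (Z j ω).2)‖ₑ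
        + ‖kernelMean P κ (fun z => g₁ z - g z) (Z j ω).2‖ₑ
        + ‖(∫ a, κ ((Z j ω).2 - a) * F a) - F (Z j ω).2‖ₑ) ∂μ := by
        refine lintegral_mono fun ω => ?_
        rw [hdecomp]
        refine (enorm_add_le _ _).trans (add_le_add ((enorm_add_le _ _).trans
          (add_le_add ((enorm_add_le _ _).trans (add_le_add ?_ le_rfl)) le_rfl)) le_rfl)
        exact enorm_average_le_average_abs _ _
    _ = ∫⁻ ω, ‖(n : ℝ)⁻¹ * ∑ v ∈ Finset.range n,
            |κ ((Z j ω).2 - (Z v ω).2) * (g (Z v ω) - g₁ (Z v ω))|‖ₑ ∂μ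
        + ∫⁻ ω, ‖(n : ℝ)⁻¹ * ∑ v ∈ Finset.range n,
          (κ ((Z j ω).2 - (Z v ω).2) * g₁ (Z v ω) - kernelMean P κ g₁ (Z j ω).2)‖ₑ ∂μ
        + ∫⁻ ω, ‖kernelMean P κ (fun z => g₁ z - g z) (Z j ω).2‖ₑ ∂μ
        + ∫⁻ ω, ‖(∫ a, κ ((Z j ω).2 - a) * F a) - F (Z j ω).2‖ₑ ∂μ := by
        rw [lintegral_add_right, lintegral_add_right, lintegral_add_right]
        · refine (Measurable.const_mul (Finset.measurable_sum _ fun v _ => ?_) _).enorm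
          have := hZ v; have := hZm v; fun_prop
        · fun_prop
        · simp only [← hconv]; fun_prop
    _ ≤ (C * L + 1) * ENNReal.ofReal δ + ENNReal.ofReal (2 * δ) + C * L * ENNReal.ofReal δ
        + C * ENNReal.ofReal δ := by
        refine add_le_add (add_le_add (add_le_add ?_ ?_) ?_) ?_
        · refine (lintegral_kernel_average_le hZ hind hlaw hC hκ (g := fun z => g z - g₁ z)
            (hg.sub hg₁m) hκB hj).trans ?_
          rw [hκL, hBn]
          refine mul_le_mul' (add_le_add le_rfl ?_) hg₁.le
          rw [← ENNReal.ofReal_one]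
          exact ENNReal.ofReal_le_ofReal hn1
        · refine (lintegral_bounded_average_sub_le hZ hind hlaw hC hκ hg₁m hA hκB hQ0
            (by rw [hκL]; exact hQle) hδ0 hj).trans (ENNReal.ofReal_le_ofReal ?_)
          have : 2 * ((h n ^ p)⁻¹ * M) * A / n + δ + 4 * ((h n ^ p)⁻¹ * M) * A * Q / (n * δ)
              = (2 * A + 4 * A * Q / δ) * ((h n ^ p)⁻¹ * M / n) + δ := by
            field_simp
            ring
          rw [this, hBn]
          linarith
        · rw [← lintegral_map (f := fun z : ℝ × Vec p =>
            ‖kernelMean P κ (fun z => g₁ z - g z) z.2‖ₑ) (hm₂.comp measurable_snd).enorm hZj, hlaw]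
          refine (lintegral_kernelMean_le hC hκ (hg₁m.sub hg)).trans ?_
          rw [hκL]
          refine mul_le_mul_right (le_trans (le_of_eq ?_) hg₁.le) _
          refine lintegral_congr fun z => ?_
          rw [← enorm_neg]; simp
        -- The bias tends to zero in $L^1$ of Lebesgue measure; domination of the law of $X$
        -- transfers this to the design points.
        · simp only [← hconv] at hn3 ⊢
          rw [← lintegral_map (f := fun z : ℝ × Vec p => ‖kernelMean P κ g z.2 - F z.2‖ₑ)
            (by fun_prop) hZj, hlaw,
            ← lintegral_map (f := fun x : Vec p => ‖kernelMean P κ g x - F x‖ₑ)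
            (by fun_prop) measurable_snd]
          refine (lintegral_mono' hC le_rfl).trans ?_
          rw [lintegral_smul_measure, smul_eq_mul]
          exact mul_le_mul_right hn3 _
    _ ≤ (2 * (C * L) + C + 4) * ENNReal.ofReal δ := by
        rw [ENNReal.ofReal_mul (by norm_num), ENNReal.ofReal_ofNat]
        have : (2 * (C * L) + C + 4) * ENNReal.ofReal δ = (C * L + 1) * ENNReal.ofReal δ
          + 2 * ENNReal.ofReal δ + C * L * ENNReal.ofReal δ + C * ENNReal.ofReal δ
          + ENNReal.ofReal δ := by ring
        rw [this]
        exact le_self_add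
    _ ≤ ε := hδ

end KernelLimits

/-! ### Convergence in probability in $[0,\infty]$ -/

section Convergence

variable {Ω : Type*} [MeasurableSpace Ω] {μ : Measure Ω}

/-- Two additive inequalities replace $|Z-I|\le W$, since subtraction in $[0,\infty]$ is truncated.
-/
lemma tendstoInProb_of_le_add {Z W : ℕ → Ω → ℝ≥0∞} {I : ℝ≥0∞} (hI : I ≠ ∞)
    (h₁ : ∀ n ω, Z n ω ≤ I + W n ω) (h₂ : ∀ n ω, I ≤ Z n ω + W n ω)
    (hW : ∀ ε > 0, Tendsto (fun n => μ {ω | ε < W n ω}) atTop (𝓝 0)) : TendstoInProb μ Z I := by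
  intro U hU
  obtain ⟨ε, hε, hεU⟩ := (ENNReal.hasBasis_nhds_of_ne_top hI).mem_iff.1 hU
  refine tendsto_of_tendsto_of_tendsto_of_le_of_le tendsto_const_nhds (hW ε hε)
    (fun _ => bot_le) fun n => measure_mono fun ω hω => ?_
  by_contra hlt
  simp only [Set.mem_ofPred_eq, not_lt] at hlt
  refine hω (hεU ⟨?_, (h₁ n ω).trans (by gcongr)⟩)
  exact tsub_le_iff_right.2 ((h₂ n ω).trans (by gcongr))

lemma TendstoInProb.tendsto_measure_le {Z : ℕ → Ω → ℝ≥0∞} (hZ : TendstoInProb μ Z ∞) {a : ℝ≥0∞}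
    (ha : a ≠ ∞) : Tendsto (fun n => μ {ω | Z n ω ≤ a}) atTop (𝓝 0) := by
  simpa using hZ (Set.Ioi a) (Ioi_mem_nhds ha.lt_top)

/-- A quantity that diverges in probability exceeds critical values bounded in probability. -/
lemma TendstoInProb.tendsto_measure_lt [IsProbabilityMeasure μ] {Z : ℕ → Ω → ℝ≥0∞}
    (hZ : TendstoInProb μ Z ∞) {c : ℕ → Ω → ℝ} (hc : BoundedAboveInProb μ c) :
    Tendsto (fun n => μ {ω | ENNReal.ofReal (c n ω) < Z n ω}) atTop (𝓝 1) := by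
  have hcompl : Tendsto (fun n => μ {ω | Z n ω ≤ ENNReal.ofReal (c n ω)}) atTop (𝓝 0) := by
    rw [ENNReal.tendsto_nhds_zero]
    intro ε hε
    obtain ⟨C, hC⟩ := hc (ε / 2) (ENNReal.half_pos hε.ne')
    have h1 := hZ.tendsto_measure_le (ENNReal.ofReal_ne_top (r := C))
    filter_upwards [hC, h1.eventually_le_const (ENNReal.half_pos hε.ne')] with n hn1 hn2
    calc μ {ω | Z n ω ≤ ENNReal.ofReal (c n ω)}
        ≤ μ ({ω | C < c n ω} ∪ {ω | Z n ω ≤ ENNReal.ofReal C}) := by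
          refine measure_mono fun ω hω => ?_
          rcases lt_or_ge C (c n ω) with h | h
          · exact Or.inl h
          · exact Or.inr (le_trans hω (ENNReal.ofReal_le_ofReal h))
      _ ≤ ε / 2 + ε / 2 := (measure_union_le _ _).trans (add_le_add hn1 hn2)
      _ = ε := ENNReal.add_halves ε
  -- No measurability of the critical values is assumed, so the lower bound rests on subadditivity
  -- and not on a complement formula.
  have hlow : Tendsto (fun n => 1 - μ {ω | Z n ω ≤ ENNReal.ofReal (c n ω)}) atTop (𝓝 1) := by
    simpa using ENNReal.Tendsto.sub (tendsto_const_nhds (x := (1 : ℝ≥0∞))) hcompl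
      (Or.inl ENNReal.one_ne_top)
  refine tendsto_of_tendsto_of_tendsto_of_le_of_le hlow tendsto_const_nhds (fun n => ?_)
    fun n => prob_le_one
  refine tsub_le_iff_right.2 ?_
  rw [← measure_univ (μ := μ)]
  refine (measure_mono fun ω _ => ?_).trans (measure_union_le _ _)
  exact lt_or_ge (ENNReal.ofReal (c n ω)) (Z n ω)

/-- Sequences that, divided by `n`, have a positive lower bound in the limit diverge. -/
lemma tendstoInProb_top_of_mul_le {Z D : ℕ → Ω → ℝ≥0∞} {I : ℝ≥0∞} (hI : 0 < I)
    (hD : TendstoInProb μ D I) (hZ : ∀ n ω, n * D n ω ≤ Z n ω) : TendstoInProb μ Z ∞ := by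
  intro U hU
  obtain ⟨a, ha⟩ := ENNReal.nhds_top_basis.mem_iff.1 hU
  -- With probability tending to one $D_n>b$, and $nb$ eventually exceeds any finite bound.
  obtain ⟨b, hb0, hbI⟩ := exists_between hI
  have h1 := hD (Set.Ioi b) (Ioi_mem_nhds hbI)
  have hbtop : Tendsto (fun n : ℕ => (n : ℝ≥0∞) * b) atTop (𝓝 ∞) := by
    have := ENNReal.Tendsto.mul_const ENNReal.tendsto_nat_nhds_top (b := b)
      (Or.inl ENNReal.top_ne_zero)
    rwa [ENNReal.top_mul hb0.ne'] at this
  refine tendsto_of_tendsto_of_tendsto_of_le_of_le' tendsto_const_nhds h1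
    (Eventually.of_forall fun _ => bot_le) ?_
  filter_upwards [hbtop.eventually (lt_mem_nhds ha.1)] with n hn
  refine measure_mono fun ω hω hlt => hω (ha.2 ?_)
  exact hn.trans_le ((mul_le_mul_right (le_of_lt hlt) _).trans (hZ n ω))

end Convergence

/-! ### Empirical and population characteristic functions -/

section CharacteristicFunctions

variable {Ω : Type*} [MeasurableSpace Ω] {μ : Measure Ω} {p : ℕ}

lemma norm_exp_I_mul_real (r : ℝ) : ‖Complex.exp (Complex.I * (r : ℂ))‖ = 1 := by
  rw [mul_comm]; exact Complex.norm_exp_ofReal_mul_I r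

lemma norm_exp_I_sub_le (a b : ℝ) :
    ‖Complex.exp (Complex.I * (a : ℂ)) - Complex.exp (Complex.I * (b : ℂ))‖ ≤ |a - b| := by
  have h : Complex.exp (Complex.I * (a : ℂ)) - Complex.exp (Complex.I * (b : ℂ))
      = Complex.exp (Complex.I * (b : ℂ)) * (Complex.exp (Complex.I * ((a - b : ℝ) : ℂ)) - 1) := by
    rw [mul_sub, ← Complex.exp_add]
    push_cast
    ring_nf
  rw [h, norm_mul, norm_exp_I_mul_real, one_mul]
  exact Real.norm_exp_I_mul_ofReal_sub_one_le

lemma norm_empiricalCF_le (n : ℕ) (x : ℕ → Vec p) (e : ℕ → ℝ) (t₁ : ℝ) (t₂ : Vec p) :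
    ‖empiricalCF n x e t₁ t₂‖ ≤ 1 := by
  rw [empiricalCF, norm_mul, norm_inv, Complex.norm_natCast]
  have : ‖∑ j ∈ Finset.range n,
      Complex.exp (Complex.I * ((inner ℝ t₂ (x j) + t₁ * e j : ℝ) : ℂ))‖ ≤ n := by
    refine (norm_sum_le _ _).trans ?_
    simp only [norm_exp_I_mul_real]
    simp
  calc (n : ℝ)⁻¹ * _ ≤ (n : ℝ)⁻¹ * n := by gcongr
    _ ≤ 1 := inv_mul_le_one

/-- Average truncated distance of two finite sequences. -/
def truncDist (n : ℕ) (e e' : ℕ → ℝ) : ℝ≥0∞ :=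
  (n : ℝ≥0∞)⁻¹ * ∑ j ∈ Finset.range n, min 1 ‖e j - e' j‖ₑ

/-- A difference of two exponentials is at most $2$ and at most $|t_1||e_j-e_j'|$. Truncating at $1$
uses both bounds, so no moments of the residuals are required. -/
lemma enorm_empiricalCF_sub_le (n : ℕ) (x : ℕ → Vec p) (e e' : ℕ → ℝ) (t₁ : ℝ) (t₂ : Vec p) :
    ‖empiricalCF n x e t₁ t₂ - empiricalCF n x e' t₁ t₂‖ₑ
      ≤ (2 + ‖t₁‖ₑ) * truncDist n e e' := by
  have hterm : ∀ j, ‖Complex.exp (Complex.I * ((inner ℝ t₂ (x j) + t₁ * e j : ℝ) : ℂ))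
      - Complex.exp (Complex.I * ((inner ℝ t₂ (x j) + t₁ * e' j : ℝ) : ℂ))‖ₑ
      ≤ (2 + ‖t₁‖ₑ) * min 1 ‖e j - e' j‖ₑ := by
    intro j
    rcases le_total 1 ‖e j - e' j‖ₑ with h | h
    · rw [min_eq_left h, mul_one]
      refine enorm_sub_le.trans (le_trans (le_of_eq ?_) le_self_add)
      rw [← ofReal_norm, ← ofReal_norm, norm_exp_I_mul_real, norm_exp_I_mul_real]
      norm_num
    · rw [min_eq_right h]
      refine le_trans ?_ (mul_le_mul_left le_add_self _)
      rw [← enorm_mul, ← ofReal_norm, ← ofReal_norm]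
      refine ENNReal.ofReal_le_ofReal ((norm_exp_I_sub_le _ _).trans (le_of_eq ?_))
      rw [Real.norm_eq_abs]
      congr 1
      ring
  rw [empiricalCF, empiricalCF, ← mul_sub, ← Finset.sum_sub_distrib, enorm_mul, truncDist,
    mul_left_comm, Finset.mul_sum]
  rcases Nat.eq_zero_or_pos n with rfl | hn
  · simp
  refine mul_le_mul' (le_of_eq ?_) ((enorm_sum_le _ _).trans (Finset.sum_le_sum fun j _ => hterm j))
  rw [enorm_inv (by exact_mod_cast hn.ne'), ← ofReal_norm, Complex.norm_natCast,
    ENNReal.ofReal_natCast]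

lemma norm_jointCF_le [IsProbabilityMeasure μ] (X : Ω → Vec p) (ε : Ω → ℝ) (t₁ : ℝ) (t₂ : Vec p) :
    ‖jointCF μ X ε t₁ t₂‖ ≤ 1 := by
  have := norm_integral_le_of_norm_le_const (μ := μ)
    (f := fun ω => Complex.exp (Complex.I * ((inner ℝ t₂ (X ω) + t₁ * ε ω : ℝ) : ℂ))) (C := 1)
    (ae_of_all _ fun ω => (norm_exp_I_mul_real _).le)
  simpa [jointCF] using this

lemma charFun_map_eq_jointCF_left {X : Ω → Vec p} (hX : Measurable X) (ε : Ω → ℝ) (t₂ : Vec p) :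
    charFun (μ.map X) t₂ = jointCF μ X ε 0 t₂ := by
  rw [charFun_apply, integral_map hX.aemeasurable (by fun_prop), jointCF]
  refine integral_congr_ae (ae_of_all _ fun ω => ?_)
  simp only [zero_mul, add_zero]
  rw [real_inner_comm, mul_comm]

lemma charFun_map_eq_jointCF_right (X : Ω → Vec p) {ε : Ω → ℝ} (hε : Measurable ε) (t₁ : ℝ) :
    charFun (μ.map ε) t₁ = jointCF μ X ε t₁ 0 := by
  rw [charFun_apply, integral_map hε.aemeasurable (by fun_prop), jointCF]
  refine integral_congr_ae (ae_of_all _ fun ω => ?_)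
  simp only [inner_zero_left, zero_add]
  rw [mul_comm]
  simp

lemma measurable_jointCF [SFinite μ] {X : Ω → Vec p} (hX : Measurable X) {ε : Ω → ℝ}
    (hε : Measurable ε) : Measurable fun t : ℝ × Vec p => jointCF μ X ε t.1 t.2 := by
  refine StronglyMeasurable.measurable (StronglyMeasurable.integral_prod_right
    (f := fun (t : ℝ × Vec p) ω =>
      Complex.exp (Complex.I * ((inner ℝ t.2 (X ω) + t.1 * ε ω : ℝ) : ℂ))) ?_)
  refine Measurable.stronglyMeasurable ?_
  unfold Function.uncurry
  fun_prop

/-- `φ_{X,ε} - φ_X φ_ε` for the empirical characteristic functions. -/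
def empiricalContrast (n : ℕ) (x : ℕ → Vec p) (e : ℕ → ℝ) (t : ℝ × Vec p) : ℂ :=
  empiricalCF n x e t.1 t.2 - empiricalCF n x e 0 t.2 * empiricalCF n x e t.1 0

/-- `φ_{X,ε} - φ_X φ_ε` for the population characteristic functions. -/
def populationContrast (μ : Measure Ω) (X : Ω → Vec p) (ε : Ω → ℝ) (t : ℝ × Vec p) : ℂ :=
  jointCF μ X ε t.1 t.2 - jointCF μ X ε 0 t.2 * jointCF μ X ε t.1 0

lemma norm_sub_mul_le_two {a b c : ℂ} (ha : ‖a‖ ≤ 1) (hb : ‖b‖ ≤ 1) (hc : ‖c‖ ≤ 1) :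
    ‖a - b * c‖ ≤ 2 := by
  refine (norm_sub_le _ _).trans ?_
  rw [norm_mul]
  nlinarith [norm_nonneg a, norm_nonneg b, norm_nonneg c]

/-- Telescoping $bc-b'c'=(b-b')c+b'(c-c')$ needs bounds on $c$ and $b'$ only. -/
lemma enorm_sub_mul_sub_le {a b c a' b' c' : ℂ} (hb : ‖b'‖ ≤ 1) (hc : ‖c‖ ≤ 1) :
    ‖(a - b * c) - (a' - b' * c')‖ₑ ≤ ‖a - a'‖ₑ + ‖b - b'‖ₑ + ‖c - c'‖ₑ := by
  have h : (a - b * c) - (a' - b' * c') = (a - a') - (b - b') * c - b' * (c - c') := by ring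
  have hb' : ‖b'‖ₑ ≤ 1 := by
    rw [← ofReal_norm]; simpa using ENNReal.ofReal_le_ofReal hb
  have hc' : ‖c‖ₑ ≤ 1 := by
    rw [← ofReal_norm]; simpa using ENNReal.ofReal_le_ofReal hc
  rw [h]
  refine enorm_sub_le.trans (add_le_add (enorm_sub_le.trans (add_le_add le_rfl ?_)) ?_)
  · rw [enorm_mul]; exact mul_le_of_le_one_right' hc'
  · rw [enorm_mul]; exact mul_le_of_le_one_left' hb'

lemma norm_empiricalContrast_le (n : ℕ) (x : ℕ → Vec p) (e : ℕ → ℝ) (t : ℝ × Vec p) :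
    ‖empiricalContrast n x e t‖ ≤ 2 :=
  norm_sub_mul_le_two (norm_empiricalCF_le _ _ _ _ _) (norm_empiricalCF_le _ _ _ _ _)
    (norm_empiricalCF_le _ _ _ _ _)

lemma norm_populationContrast_le [IsProbabilityMeasure μ] (X : Ω → Vec p) (ε : Ω → ℝ)
    (t : ℝ × Vec p) : ‖populationContrast μ X ε t‖ ≤ 2 :=
  norm_sub_mul_le_two (norm_jointCF_le _ _ _ _) (norm_jointCF_le _ _ _ _) (norm_jointCF_le _ _ _ _)

/-- The factor at $t_1=0$ does not involve the errors, so two differences remain. The cap $4$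
provides domination when $|t_1|$ is not integrable for the frequency measure. -/
lemma enorm_empiricalContrast_sub_le (n : ℕ) (x : ℕ → Vec p) (e e' : ℕ → ℝ) (t : ℝ × Vec p) :
    ‖empiricalContrast n x e t - empiricalContrast n x e' t‖ₑ
      ≤ min 4 (2 * (2 + ‖t.1‖ₑ) * truncDist n e e') := by
  refine le_min ?_ ?_
  · refine enorm_sub_le.trans ?_
    rw [← ofReal_norm, ← ofReal_norm,
      ← ENNReal.ofReal_add (norm_nonneg _) (norm_nonneg _)]
    refine (ENNReal.ofReal_le_ofReal (add_le_add (norm_empiricalContrast_le _ _ _ _)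
      (norm_empiricalContrast_le _ _ _ _))).trans ?_
    norm_num
  · refine (enorm_sub_mul_sub_le (norm_empiricalCF_le _ _ _ _ _)
      (norm_empiricalCF_le _ _ _ _ _)).trans ?_
    have h0 : empiricalCF n x e 0 t.2 = empiricalCF n x e' 0 t.2 := by simp [empiricalCF]
    rw [h0, sub_self, enorm_zero, add_zero, mul_assoc, two_mul]
    exact add_le_add (enorm_empiricalCF_sub_le _ _ _ _ _ _) (enorm_empiricalCF_sub_le _ _ _ _ _ _)

/-- Factor $\|a\|^2-\|b\|^2$; the sum of the norms is at most $4$. -/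
lemma ofReal_norm_sq_le_add {a b : ℂ} (ha : ‖a‖ ≤ 2) (hb : ‖b‖ ≤ 2) :
    ENNReal.ofReal (‖a‖ ^ 2) ≤ ENNReal.ofReal (‖b‖ ^ 2) + 4 * ‖a - b‖ₑ := by
  have h4 : (4 : ℝ≥0∞) = ENNReal.ofReal 4 := by norm_num
  rw [← ofReal_norm, h4, ← ENNReal.ofReal_mul (by norm_num),
    ← ENNReal.ofReal_add (by positivity) (by positivity)]
  refine ENNReal.ofReal_le_ofReal ?_
  have := norm_sub_norm_le a b
  nlinarith [norm_nonneg a, norm_nonneg b, norm_nonneg (a - b)]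

end CharacteristicFunctions

/-! ### Limit of the integrated squared contrast -/

section Limits

variable {Ω : Type*} [MeasurableSpace Ω] {μ : Measure Ω} [IsProbabilityMeasure μ] {p : ℕ}
  {X : ℕ → Ω → Vec p} {ε : ℕ → Ω → ℝ}

/-- `L¹` law of large numbers for the empirical characteristic function. -/
lemma tendsto_lintegral_empiricalCF_sub (hX : ∀ j, Measurable (X j)) (hε : ∀ j, Measurable (ε j))
    (hind : iIndepFun (fun j ω => (ε j ω, X j ω)) μ)
    (hident : ∀ j, IdentDistrib (fun ω => (ε j ω, X j ω)) (fun ω => (ε 0 ω, X 0 ω)) μ μ)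
    (t₁ : ℝ) (t₂ : Vec p) :
    Tendsto (fun n => ∫⁻ ω, ‖empiricalCF n (fun j => X j ω) (fun j => ε j ω) t₁ t₂
      - jointCF μ (X 0) (ε 0) t₁ t₂‖ₑ ∂μ) atTop (𝓝 0) := by
  set ψ : ℝ × Vec p → ℂ := fun z =>
    Complex.exp (Complex.I * ((inner ℝ t₂ z.2 + t₁ * z.1 : ℝ) : ℂ)) with hψ
  have hψm : Measurable ψ := by fun_prop
  have h0 : MemLp (fun ω => ψ (ε 0 ω, X 0 ω)) 1 μ := by
    have := hX 0; have := hε 0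
    exact MemLp.of_bound (Measurable.aestronglyMeasurable (by fun_prop)) 1
      (ae_of_all _ fun ω => (norm_exp_I_mul_real _).le)
  have h := strong_law_Lp le_rfl ENNReal.one_ne_top (fun j ω => ψ (ε j ω, X j ω)) h0
    (fun i j hij => (hind.indepFun hij).comp hψm hψm) (fun j => (hident j).comp hψm)
  simp only [eLpNorm_one_eq_lintegral_enorm] at h
  refine h.congr fun n => lintegral_congr fun ω => ?_
  simp only [empiricalCF, jointCF, hψ, Complex.real_smul]
  push_cast
  rfl

lemma measurable_empiricalCF (hX : ∀ j, Measurable (X j)) (hε : ∀ j, Measurable (ε j)) (n : ℕ) :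
    Measurable fun z : (ℝ × Vec p) × Ω =>
      empiricalCF n (fun j => X j z.2) (fun j => ε j z.2) z.1.1 z.1.2 := by
  unfold empiricalCF
  refine (Finset.measurable_sum _ fun j _ => ?_).const_mul _
  have := hX j; have := hε j
  fun_prop

/-- After Tonelli the inner expectation tends to zero for each $t$ by the law of large numbers, and
it is bounded by $4$ on a finite measure space. -/
lemma tendsto_lintegral_contrast_sub (hX : ∀ j, Measurable (X j)) (hε : ∀ j, Measurable (ε j))
    (hind : iIndepFun (fun j ω => (ε j ω, X j ω)) μ)
    (hident : ∀ j, IdentDistrib (fun ω => (ε j ω, X j ω)) (fun ω => (ε 0 ω, X 0 ω)) μ μ)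
    (ν : Measure (ℝ × Vec p)) [IsFiniteMeasure ν] :
    Tendsto (fun n => ∫⁻ ω, ∫⁻ t, ‖empiricalContrast n (fun j => X j ω) (fun j => ε j ω) t
      - populationContrast μ (X 0) (ε 0) t‖ₑ ∂ν ∂μ) atTop (𝓝 0) := by
  have hem := measurable_empiricalCF hX hε
  have hjm := measurable_jointCF (μ := μ) (hX 0) (hε 0)
  have hm : ∀ n, Measurable fun z : (ℝ × Vec p) × Ω =>
      ‖empiricalContrast n (fun j => X j z.2) (fun j => ε j z.2) z.1
        - populationContrast μ (X 0) (ε 0) z.1‖ₑ := by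
    intro n
    unfold empiricalContrast populationContrast
    have h1 : Measurable fun z : (ℝ × Vec p) × Ω =>
        empiricalCF n (fun j => X j z.2) (fun j => ε j z.2) 0 z.1.2 :=
      (hem n).comp (g := _) (f := fun z : (ℝ × Vec p) × Ω => (((0 : ℝ), z.1.2), z.2)) (by fun_prop)
    have h2 : Measurable fun z : (ℝ × Vec p) × Ω =>
        empiricalCF n (fun j => X j z.2) (fun j => ε j z.2) z.1.1 0 :=
      (hem n).comp (g := _) (f := fun z : (ℝ × Vec p) × Ω => ((z.1.1, (0 : Vec p)), z.2))
        (by fun_prop)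
    have h3 : Measurable fun z : (ℝ × Vec p) × Ω => jointCF μ (X 0) (ε 0) z.1.1 z.1.2 :=
      hjm.comp measurable_fst
    have h4 : Measurable fun z : (ℝ × Vec p) × Ω => jointCF μ (X 0) (ε 0) 0 z.1.2 :=
      hjm.comp (g := _) (f := fun z : (ℝ × Vec p) × Ω => ((0 : ℝ), z.1.2)) (by fun_prop)
    have h5 : Measurable fun z : (ℝ × Vec p) × Ω => jointCF μ (X 0) (ε 0) z.1.1 0 :=
      hjm.comp (g := _) (f := fun z : (ℝ × Vec p) × Ω => (z.1.1, (0 : Vec p))) (by fun_prop)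
    exact (((hem n).sub (h1.mul h2)).sub (h3.sub (h4.mul h5))).enorm
  have hswap : ∀ n, ∫⁻ ω, ∫⁻ t, ‖empiricalContrast n (fun j => X j ω) (fun j => ε j ω) t
      - populationContrast μ (X 0) (ε 0) t‖ₑ ∂ν ∂μ
      = ∫⁻ t, ∫⁻ ω, ‖empiricalContrast n (fun j => X j ω) (fun j => ε j ω) t
      - populationContrast μ (X 0) (ε 0) t‖ₑ ∂μ ∂ν := fun n =>
    (lintegral_lintegral_swap (hm n).aemeasurable).symm
  simp only [hswap]
  have hlim := tendsto_lintegral_of_dominated_convergence (μ := ν)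
    (F := fun n t => ∫⁻ ω, ‖empiricalContrast n (fun j => X j ω) (fun j => ε j ω) t
      - populationContrast μ (X 0) (ε 0) t‖ₑ ∂μ) (f := fun _ => 0) (fun _ => 4)
    (fun n => (hm n).lintegral_prod_right') ?_ ?_ ?_
  · simpa using hlim
  · refine fun n => ae_of_all _ fun t => ?_
    refine (lintegral_mono (g := fun _ => (4 : ℝ≥0∞)) fun ω => ?_).trans (by simp)
    refine enorm_sub_le.trans ?_
    rw [← ofReal_norm, ← ofReal_norm,
      ← ENNReal.ofReal_add (norm_nonneg _) (norm_nonneg _)]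
    refine (ENNReal.ofReal_le_ofReal (add_le_add (norm_empiricalContrast_le _ _ _ _)
      (norm_populationContrast_le _ _ _))).trans ?_
    norm_num
  · simp [ENNReal.mul_eq_top]
  · refine ae_of_all _ fun t => ?_
    have hsum := ((tendsto_lintegral_empiricalCF_sub hX hε hind hident t.1 t.2).add
      (tendsto_lintegral_empiricalCF_sub hX hε hind hident 0 t.2)).add
      (tendsto_lintegral_empiricalCF_sub hX hε hind hident t.1 0)
    simp only [add_zero] at hsum
    refine tendsto_of_tendsto_of_tendsto_of_le_of_le tendsto_const_nhds hsum
      (fun _ => bot_le) fun n => ?_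
    have hmeas : ∀ (s₁ : ℝ) (s₂ : Vec p), Measurable fun ω =>
        ‖empiricalCF n (fun j => X j ω) (fun j => ε j ω) s₁ s₂ - jointCF μ (X 0) (ε 0) s₁ s₂‖ₑ :=
      fun s₁ s₂ => (((hem n).comp (g := _) (f := fun ω : Ω => ((s₁, s₂), ω))
        (by fun_prop)).sub_const _).enorm
    simp only
    rw [← lintegral_add_right _ (hmeas _ _), ← lintegral_add_right _ (hmeas _ _)]
    exact lintegral_mono fun ω => enorm_sub_mul_sub_le (norm_jointCF_le _ _ _ _)
      (norm_empiricalCF_le _ _ _ _ _)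

/-- The integrated squared contrast of the estimated errors converges in probability to the
population value if the estimated errors are close to the true ones on average. -/
theorem tendstoInProb_lintegral_contrast (hX : ∀ j, Measurable (X j))
    (hε : ∀ j, Measurable (ε j)) (hind : iIndepFun (fun j ω => (ε j ω, X j ω)) μ)
    (hident : ∀ j, IdentDistrib (fun ω => (ε j ω, X j ω)) (fun ω => (ε 0 ω, X 0 ω)) μ μ)
    (ν : Measure (ℝ × Vec p)) [IsFiniteMeasure ν] {e : ℕ → Ω → ℕ → ℝ}
    (he : ∀ η > 0, Tendsto (fun n => μ {ω | η < truncDist n (e n ω) (fun j => ε j ω)}) atTop (𝓝 0)) :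
    TendstoInProb μ (fun n ω => ∫⁻ t,
        ENNReal.ofReal (‖empiricalContrast n (fun j => X j ω) (e n ω) t‖ ^ 2) ∂ν)
      (∫⁻ t, ENNReal.ofReal (‖populationContrast μ (X 0) (ε 0) t‖ ^ 2) ∂ν) := by
  set I := ∫⁻ t, ENNReal.ofReal (‖populationContrast μ (X 0) (ε 0) t‖ ^ 2) ∂ν with hI
  have hIfin : I ≠ ∞ := by
    refine ne_top_of_le_ne_top (b := ∫⁻ _, ENNReal.ofReal (2 ^ 2) ∂ν) ?_ ?_
    · simp [ENNReal.mul_eq_top]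
    · exact lintegral_mono fun t => ENNReal.ofReal_le_ofReal
        (pow_le_pow_left₀ (norm_nonneg _) (norm_populationContrast_le _ _ _) 2)
  -- $H(s)$ bounds the cost of replacing the errors when the truncated distance is $s$; it vanishes
  -- as $s\to0$ by domination with $4$.
  set H : ℝ≥0∞ → ℝ≥0∞ := fun s => ∫⁻ t, min 4 (2 * (2 + ‖t.1‖ₑ) * s) ∂ν with hH
  have hHlim : Tendsto H (𝓝 0) (𝓝 0) := by
    have hlim := tendsto_lintegral_filter_of_dominated_convergence (μ := ν) (l := 𝓝 (0 : ℝ≥0∞))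
      (F := fun (s : ℝ≥0∞) (t : ℝ × Vec p) => min 4 (2 * (2 + ‖t.1‖ₑ) * s)) (f := fun _ => 0)
      (fun _ => 4) (Eventually.of_forall fun s => by fun_prop)
      (Eventually.of_forall fun s => ae_of_all _ fun t => min_le_left _ _)
      (by simp [ENNReal.mul_eq_top]) (ae_of_all _ fun t => ?_)
    · simpa using hlim
    · have h1 : Tendsto (fun s : ℝ≥0∞ => 2 * (2 + ‖t.1‖ₑ) * s) (𝓝 0) (𝓝 0) := by
        simpa using ENNReal.Tendsto.const_mul (tendsto_id (x := 𝓝 (0 : ℝ≥0∞)))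
          (a := 2 * (2 + ‖t.1‖ₑ)) (Or.inr (by finiteness))
      simpa using (tendsto_const_nhds (x := (4 : ℝ≥0∞))).min h1
  set J : ℕ → Ω → ℝ≥0∞ := fun n ω => ∫⁻ t,
    ‖empiricalContrast n (fun j => X j ω) (fun j => ε j ω) t
      - populationContrast μ (X 0) (ε 0) t‖ₑ ∂ν with hJ
  have hem := measurable_empiricalCF hX hε
  have hjm := measurable_jointCF (μ := μ) (hX 0) (hε 0)
  have hcm : ∀ n ω, Measurable fun t => empiricalContrast n (fun j => X j ω) (e n ω) t := by
    intro n ω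
    unfold empiricalContrast empiricalCF
    fun_prop
  have hcm' : ∀ n ω, Measurable fun t =>
      empiricalContrast n (fun j => X j ω) (fun j => ε j ω) t := by
    intro n ω
    unfold empiricalContrast empiricalCF
    fun_prop
  have hpm : Measurable fun t => populationContrast μ (X 0) (ε 0) t := by
    unfold populationContrast
    exact hjm.sub ((hjm.comp (g := _) (f := fun t : ℝ × Vec p => ((0 : ℝ), t.2)) (by fun_prop)).mul
      (hjm.comp (g := _) (f := fun t : ℝ × Vec p => (t.1, (0 : Vec p))) (by fun_prop)))
  have hd : ∀ n ω, Measurable fun t => ‖empiricalContrast n (fun j => X j ω) (e n ω) t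
      - populationContrast μ (X 0) (ε 0) t‖ₑ := fun n ω => ((hcm n ω).sub hpm).enorm
  have hd' : ∀ n ω, Measurable fun t =>
      ‖empiricalContrast n (fun j => X j ω) (fun j => ε j ω) t
      - populationContrast μ (X 0) (ε 0) t‖ₑ := fun n ω => ((hcm' n ω).sub hpm).enorm
  have hdiff : ∀ n ω, ∫⁻ t, ‖empiricalContrast n (fun j => X j ω) (e n ω) t
      - populationContrast μ (X 0) (ε 0) t‖ₑ ∂ν
      ≤ H (truncDist n (e n ω) (fun j => ε j ω)) + J n ω := by
    intro n ω
    rw [hH, hJ]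
    simp only
    rw [← lintegral_add_right _ (hd' n ω)]
    refine lintegral_mono fun t => ?_
    refine le_trans ?_ (add_le_add_left (enorm_empiricalContrast_sub_le n (fun j => X j ω) _ _ t) _)
    refine le_trans (le_of_eq ?_) (enorm_add_le _ _)
    rw [sub_add_sub_cancel]
  refine tendstoInProb_of_le_add
    (W := fun n ω => 4 * (H (truncDist n (e n ω) (fun j => ε j ω)) + J n ω)) hIfin ?_ ?_ ?_
  · intro n ω
    refine le_trans ?_ (add_le_add_right (mul_le_mul_right (hdiff n ω) 4) _)
    rw [← lintegral_const_mul _ (hd n ω), hI,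
      ← lintegral_add_right _ ((hd n ω).const_mul 4)]
    exact lintegral_mono fun t => ofReal_norm_sq_le_add (norm_empiricalContrast_le _ _ _ _)
      (norm_populationContrast_le _ _ _)
  · intro n ω
    refine le_trans ?_ (add_le_add_right (mul_le_mul_right (hdiff n ω) 4) _)
    rw [← lintegral_const_mul _ (hd n ω), hI,
      ← lintegral_add_right _ ((hd n ω).const_mul 4)]
    refine lintegral_mono fun t => ?_
    have := ofReal_norm_sq_le_add (norm_populationContrast_le (μ := μ) (X 0) (ε 0) t)
      (norm_empiricalContrast_le n (fun j => X j ω) (e n ω) t)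
    rwa [← enorm_neg, neg_sub] at this
  · intro η hη
    -- The error is $4(H+J)$, so each of $H$ and $J$ may use $\eta/8$.
    set η' : ℝ≥0∞ := η / 4 / 2 with hη'
    have hη'0 : 0 < η' := ENNReal.half_pos (ENNReal.div_pos hη.ne' (by simp)).ne'
    obtain ⟨s, hs0, hs⟩ : ∃ s > 0, ∀ s' ≤ s, H s' ≤ η' := by
      obtain ⟨s, hs, hs'⟩ := ENNReal.nhds_zero_basis_Iic.mem_iff.1
        (hHlim.eventually_le_const hη'0)
      exact ⟨s, hs, fun s' h => hs' h⟩
    have hEJ : Tendsto (fun n => (∫⁻ ω, J n ω ∂μ) / η') atTop (𝓝 0) := by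
      have := ENNReal.Tendsto.div_const (tendsto_lintegral_contrast_sub hX hε hind hident ν)
        (b := η') (Or.inr hη'0.ne')
      simpa using this
    have hsum := (he s hs0).add hEJ
    rw [add_zero] at hsum
    refine tendsto_of_tendsto_of_tendsto_of_le_of_le' tendsto_const_nhds hsum
      (Eventually.of_forall fun _ => bot_le) ?_
    -- Markov's inequality needs a finite threshold; for $\eta=\infty$ the event is empty.
    by_cases hηtop : η = ∞
    · refine Eventually.of_forall fun n => ?_
      simp [hηtop]
    have hJm : ∀ n, Measurable (J n) := by
      intro n
      have : Measurable fun z : Ω × (ℝ × Vec p) =>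
          ‖empiricalContrast n (fun j => X j z.1) (fun j => ε j z.1) z.2
          - populationContrast μ (X 0) (ε 0) z.2‖ₑ := by
        refine (Measurable.sub ?_ (hpm.comp measurable_snd)).enorm
        unfold empiricalContrast
        exact ((hem n).comp (g := _) (f := fun z : Ω × (ℝ × Vec p) => (z.2, z.1)) (by fun_prop)).sub
          (((hem n).comp (g := _) (f := fun z : Ω × (ℝ × Vec p) => (((0 : ℝ), z.2.2), z.1))
            (by fun_prop)).mul ((hem n).comp (g := _)
            (f := fun z : Ω × (ℝ × Vec p) => ((z.2.1, (0 : Vec p)), z.1)) (by fun_prop)))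
      exact this.lintegral_prod_right'
    refine Eventually.of_forall fun n => ?_
    calc _ ≤ μ ({ω | s < truncDist n (e n ω) (fun j => ε j ω)} ∪ {ω | η' ≤ J n ω}) := by
          refine measure_mono fun ω hω => ?_
          by_contra hcon
          rw [Set.mem_union, not_or] at hcon
          simp only [Set.mem_ofPred_eq, not_lt, not_le] at hcon
          refine absurd (show η < _ from hω) (not_lt.2 ?_)
          calc 4 * (H (truncDist n (e n ω) (fun j => ε j ω)) + J n ω)
              ≤ 4 * (η' + η') := by
                gcongr
                · exact hs _ hcon.1
                · exact hcon.2.le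
            _ = η := by
                rw [hη', ENNReal.add_halves, ENNReal.mul_div_cancel (by simp) (by simp)]
      _ ≤ _ := (measure_union_le _ _).trans (add_le_add le_rfl
          (meas_ge_le_lintegral_div (hJm n).aemeasurable hη'0.ne'
            (by rw [hη']; finiteness)))

end Limits

/-! ### Continuous mapping for sample averages -/

section ContinuousMapping

variable {Ω : Type*} [MeasurableSpace Ω] {μ : Measure Ω}

/-- Continuous mapping for averages over the sample: if `Vhat n j` is close to `V j` in mean,
uniformly in `j < n` and outside small events, then `Ψ (Vhat n j)` is close to `Ψ (V j)` on
average. -/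
theorem tendsto_measure_truncDist_of_continuousOn {E : Type*} [PseudoEMetricSpace E] [T2Space E]
    [MeasurableSpace E] [BorelSpace E] {ν : Measure E} [IsProbabilityMeasure ν]
    [ν.InnerRegularCompactLTTop] {V : ℕ → Ω → E} (hV : ∀ j, Measurable (V j))
    (hlaw : ∀ j, μ.map (V j) = ν) {U : Set E} (hU : IsOpen U) (hνU : ν Uᶜ = 0) {Ψ : E → ℝ}
    (hΨ : ContinuousOn Ψ U) {Vhat : ℕ → ℕ → Ω → E}
    (happrox : ∀ ρ > 0, ∃ bad : ℕ → Set Ω, ∀ᶠ n in atTop, μ (bad n) ≤ ρ ∧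
      ∃ G : ℕ → Ω → ℝ≥0∞, (∀ j, Measurable (G j)) ∧ ∀ j < n, ∫⁻ ω, G j ω ∂μ ≤ ρ ∧
        ∀ ω ∉ bad n, edist (V j ω) (Vhat n j ω) ≤ G j ω) {η : ℝ≥0∞} (hη : 0 < η) :
    Tendsto (fun n => μ {ω | η < truncDist n (fun j => Ψ (Vhat n j ω)) (fun j => Ψ (V j ω))})
      atTop (𝓝 0) := by
  rw [ENNReal.tendsto_nhds_zero]
  intro τ hτ
  obtain ⟨c, hc0, hcη⟩ : ∃ c : ℝ≥0∞, 0 < c ∧ c ≠ ∞ ∧ c + c ≤ η := by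
    refine ⟨min η 1 / 2, ENNReal.half_pos (lt_min hη one_pos).ne',
      ENNReal.div_ne_top (ne_top_of_le_ne_top ENNReal.one_ne_top (min_le_right _ _)) (by simp), ?_⟩
    rw [ENNReal.add_halves]
    exact min_le_left _ _
  obtain ⟨hcfin, hcη⟩ := hcη
  -- Markov at level $c$ turns a mean of $\tau c/3$ into a probability $\tau/3$. This is spent once
  -- on leaving $K$ and once on $G$; the bad event takes the last third.
  have hρ : 0 < τ / 3 * c := ENNReal.mul_pos (ENNReal.div_pos hτ.ne' (by simp)).ne' hc0.ne'
  obtain ⟨K, hKU, hK, hνK⟩ := hU.measurableSet.exists_isCompact_sdiff_lt (μ := ν)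
    (measure_ne_top _ _) hρ.ne'
  have hνKc : ν Kᶜ ≤ τ / 3 * c := by
    calc ν Kᶜ ≤ ν (U \ K ∪ Uᶜ) := measure_mono fun v hv => by
          by_cases h : v ∈ U
          · exact Or.inl ⟨h, hv⟩
          · exact Or.inr h
      _ ≤ ν (U \ K) + ν Uᶜ := measure_union_le _ _
      _ ≤ _ := by rw [hνU, add_zero]; exact hνK.le
  -- On a compact subset of the open domain continuity is uniform, also towards points $v'$ outside
  -- $K$.
  obtain ⟨δ, hδ0, hδ⟩ : ∃ δ : ℝ≥0∞, 0 < δ ∧ ∀ v ∈ K, ∀ v', edist v v' < δ →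
      edist (Ψ v) (Ψ v') < c := by
    have := hK.uniformContinuousAt_of_continuousAt Ψ
      (fun v hv => hΨ.continuousAt (hU.mem_nhds (hKU hv))) (edist_mem_uniformity hc0)
    obtain ⟨δ, hδ0, hδ⟩ := mem_uniformity_edist.1 this
    exact ⟨δ, hδ0, fun v hv v' h => hδ h hv⟩
  have hKm : MeasurableSet K := hK.measurableSet
  obtain ⟨δ', hδ'0, hδ'fin, hδ'⟩ : ∃ δ' : ℝ≥0∞, 0 < δ' ∧ δ' ≠ ∞ ∧ δ' ≤ δ :=
    ⟨min δ 1, lt_min hδ0 one_pos, ne_top_of_le_ne_top ENNReal.one_ne_top (min_le_right _ _),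
      min_le_left _ _⟩
  have hρ' : 0 < min (τ / 3) (τ / 3 * c * δ') := by
    have : 0 < τ / 3 * c * δ' := ENNReal.mul_pos hρ.ne' hδ'0.ne'
    have : 0 < τ / 3 := ENNReal.div_pos hτ.ne' (by simp)
    positivity
  obtain ⟨bad, hbad⟩ := happrox _ hρ'
  filter_upwards [hbad, eventually_gt_atTop 0] with n ⟨hn1, G, hGm, hG⟩ hn0
  -- At least $1$ whenever uniform continuity is not applicable, which is enough for a distance
  -- truncated at $1$.
  set r : ℕ → Ω → ℝ≥0∞ := fun j ω => Kᶜ.indicator 1 (V j ω) + G j ω / δ' with hr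
  have hrm : ∀ j, Measurable (r j) := fun j =>
    ((measurable_one.indicator hKm.compl).comp (hV j)).add ((hGm j).div_const _)
  have hn0' : (n : ℝ≥0∞) ≠ 0 := by exact_mod_cast hn0.ne'
  have hpt : ∀ ω ∉ bad n, ∀ j < n, min 1 ‖Ψ (Vhat n j ω) - Ψ (V j ω)‖ₑ ≤ c + r j ω := by
    intro ω hω j hj
    by_cases hVK : V j ω ∈ K
    · rcases lt_or_ge (G j ω) δ' with hlt | hge
      · have := hδ _ hVK (Vhat n j ω) ((((hG j hj).2 ω hω).trans_lt hlt).trans_le hδ')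
        refine (min_le_right _ _).trans (le_trans ?_ le_self_add)
        rw [← edist_eq_enorm_sub, edist_comm]
        exact this.le
      · refine (min_le_left _ _).trans (le_trans ?_ le_add_self)
        refine le_trans ?_ le_add_self
        rw [ENNReal.le_div_iff_mul_le (Or.inl hδ'0.ne') (Or.inl hδ'fin), one_mul]
        exact hge
    · refine (min_le_left _ _).trans (le_trans ?_ le_add_self)
      refine le_trans ?_ le_self_add
      rw [Set.indicator_of_mem hVK]
      simp
  set Rn : Ω → ℝ≥0∞ := fun ω => (n : ℝ≥0∞)⁻¹ * ∑ j ∈ Finset.range n, r j ω with hRn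
  have hRm : Measurable Rn := (Finset.measurable_sum _ fun j _ => hrm j).const_mul _
  have htr : ∀ ω ∉ bad n, truncDist n (fun j => Ψ (Vhat n j ω)) (fun j => Ψ (V j ω))
      ≤ c + Rn ω := by
    intro ω hω
    calc _ ≤ (n : ℝ≥0∞)⁻¹ * ∑ j ∈ Finset.range n, (c + r j ω) := by
          refine mul_le_mul_right (Finset.sum_le_sum fun j hj => ?_) _
          exact hpt ω hω j (Finset.mem_range.1 hj)
      _ = c + Rn ω := by
          rw [Finset.sum_add_distrib, mul_add, Finset.sum_const, Finset.card_range, nsmul_eq_mul,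
            ← mul_assoc, ENNReal.inv_mul_cancel hn0' (ENNReal.natCast_ne_top n), one_mul]
  have hER : ∫⁻ ω, Rn ω ∂μ ≤ τ / 3 * c + τ / 3 * c := by
    rw [lintegral_const_mul _ (Finset.measurable_sum _ fun j _ => hrm j),
      lintegral_finsetSum _ fun j _ => hrm j]
    have hj : ∀ j ∈ Finset.range n, ∫⁻ ω, r j ω ∂μ ≤ τ / 3 * c + τ / 3 * c := by
      intro j hj
      simp only [hr]
      rw [lintegral_add_right _ ((hGm j).div_const _)]
      refine add_le_add ?_ ?_
      · rw [← lintegral_map (measurable_one.indicator hKm.compl) (hV j), hlaw,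
          lintegral_indicator_one hKm.compl]
        exact hνKc
      · simp only [div_eq_mul_inv]
        rw [lintegral_mul_const _ (hGm j), ← div_eq_mul_inv]
        refine ENNReal.div_le_of_le_mul ?_
        exact ((hG j (Finset.mem_range.1 hj)).1).trans (min_le_right _ _)
    calc _ ≤ (n : ℝ≥0∞)⁻¹ * (n * (τ / 3 * c + τ / 3 * c)) := by
          refine mul_le_mul_right ((Finset.sum_le_card_nsmul _ _ _ hj).trans ?_) _
          simp only [Finset.card_range, nsmul_eq_mul, le_refl]
      _ = _ := by
          rw [← mul_assoc, ENNReal.inv_mul_cancel hn0' (ENNReal.natCast_ne_top n), one_mul]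
  calc _ ≤ μ (bad n ∪ {ω | c ≤ Rn ω}) := by
        refine measure_mono fun ω hω => ?_
        by_contra hcon
        rw [Set.mem_union, not_or] at hcon
        obtain ⟨h1, h2⟩ := hcon
        refine absurd (show η < _ from hω) (not_lt.2 ((htr ω h1).trans (le_trans ?_ hcη)))
        gcongr
        exact (not_le.1 h2).le
    _ ≤ τ / 3 + (τ / 3 * c + τ / 3 * c) / c := by
        refine (measure_union_le _ _).trans (add_le_add (hn1.trans (min_le_left _ _)) ?_)
        exact (meas_ge_le_lintegral_div hRm.aemeasurable hc0.ne' hcfin).trans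
          (ENNReal.div_le_div_right hER _)
    _ = τ := by
        rw [ENNReal.add_div, ENNReal.mul_div_cancel_right hc0.ne' hcfin, ← add_assoc,
          ENNReal.add_thirds]

end ContinuousMapping

/-! ### Residuals as a continuous function of kernel averages -/

section Studentize

variable {p : ℕ}

/-- The residual as a function of the kernel averages of `1`, `τ(y)`, `τ(y)²` and of `τ(y_j)`. -/
def studentize (v : ℝ × ℝ × ℝ × ℝ) : ℝ :=
  (v.2.2.2 - v.1⁻¹ * v.2.1) /
    √(v.1⁻¹ * (v.2.2.1 - 2 * (v.1⁻¹ * v.2.1) * v.2.1 + (v.1⁻¹ * v.2.1) ^ 2 * v.1))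

/-- Only the square in the variance estimator is expanded and nothing is cancelled, so the identity
also holds where the density estimator vanishes. -/
lemma residual_eq_studentize (n : ℕ) (h : ℝ) (k : ℝ → ℝ) (τ : ℝ → ℝ) (y : ℕ → ℝ)
    (x : ℕ → Vec p) (j : ℕ) :
    residual n h k τ y x j = studentize (kernelAverage n h k x (fun _ => 1) (x j),
      kernelAverage n h k x (fun v => τ (y v)) (x j),
      kernelAverage n h k x (fun v => τ (y v) ^ 2) (x j), τ (y j)) := by
  have hlin : ∀ (c : ℝ) (a : Vec p), kernelAverage n h k x (fun v => (τ (y v) - c) ^ 2) a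
      = kernelAverage n h k x (fun v => τ (y v) ^ 2) a
        - 2 * c * kernelAverage n h k x (fun v => τ (y v)) a
        + c ^ 2 * kernelAverage n h k x (fun _ => 1) a := by
    intro c a
    simp only [kernelAverage]
    rw [mul_left_comm (2 * c), mul_left_comm (c ^ 2), ← mul_sub, ← mul_add]
    congr 1
    rw [Finset.mul_sum, Finset.mul_sum, ← Finset.sum_sub_distrib, ← Finset.sum_add_distrib]
    exact Finset.sum_congr rfl fun v _ => by ring
  simp only [residual, varEst, hlin, studentize, meanEst, densityEst]

/-- The domain on which `studentize` is continuous. -/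
def studentizeDomain : Set (ℝ × ℝ × ℝ × ℝ) := {v | 0 < v.1 ∧ v.2.1 ^ 2 < v.1 * v.2.2.1}

lemma isOpen_studentizeDomain : IsOpen studentizeDomain := by
  have h1 : IsOpen {v : ℝ × ℝ × ℝ × ℝ | 0 < v.1} := isOpen_lt (by fun_prop) (by fun_prop)
  have h2 : IsOpen {v : ℝ × ℝ × ℝ × ℝ | v.2.1 ^ 2 < v.1 * v.2.2.1} :=
    isOpen_lt (by fun_prop) (by fun_prop)
  exact h1.inter h2

lemma continuousOn_studentize : ContinuousOn studentize studentizeDomain := by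
  have h0 : ∀ v ∈ studentizeDomain, v.1 ≠ 0 := fun v hv => hv.1.ne'
  have hinv : ContinuousOn (fun v : ℝ × ℝ × ℝ × ℝ => v.1⁻¹) studentizeDomain :=
    continuousOn_fst.inv₀ h0
  unfold studentize
  refine ContinuousOn.div (by fun_prop) (ContinuousOn.sqrt (by fun_prop)) fun v hv => ?_
  have hv1 : 0 < v.1 := hv.1
  have hv2 : v.2.1 ^ 2 < v.1 * v.2.2.1 := hv.2
  -- The second inequality of the domain says exactly that the variance is positive.
  have : v.1⁻¹ * (v.2.2.1 - 2 * (v.1⁻¹ * v.2.1) * v.2.1 + (v.1⁻¹ * v.2.1) ^ 2 * v.1)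
      = (v.1 * v.2.2.1 - v.2.1 ^ 2) / v.1 ^ 2 := by
    field_simp
    ring
  rw [this]
  exact (Real.sqrt_pos.2 (div_pos (by linarith) (by positivity))).ne'

/-- Identifies the limit with the model error; by the convention for division by zero this includes
$\sigma=0$. -/
lemma studentize_eq {f m σ t : ℝ} (hf : 0 < f) (hσ : 0 ≤ σ) :
    studentize (f, m * f, (m ^ 2 + σ ^ 2) * f, t) = (t - m) / σ := by
  have h1 : f⁻¹ * (m * f) = m := by field_simp
  have h2 : f⁻¹ * ((m ^ 2 + σ ^ 2) * f - 2 * m * (m * f) + m ^ 2 * f) = σ ^ 2 := by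
    field_simp
    ring
  simp only [studentize, h1, h2, Real.sqrt_sq hσ]

end Studentize

/-! ### Square integrable Lipschitz envelope in the parameter -/

section Envelope

variable {Ω : Type*} [MeasurableSpace Ω] {μ : Measure Ω} {p q : ℕ} {Y₀ : Ω → ℝ} {X₀ : Ω → Vec p}
  {Θ : Set (Vec q)} {T : Vec q → ℝ → ℝ} {m : Vec q → Vec p → ℝ} {θ₀ : Vec q}

/-- Near `θ₀` the transformations are Lipschitz in the parameter, almost surely simultaneously for
all parameters, with a square integrable constant. -/
lemma SmoothTransformations.exists_envelope (hs : SmoothTransformations μ Y₀ X₀ Θ T m θ₀)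
    (hY : Measurable Y₀) (hθ₀ : θ₀ ∈ Θ) :
    ∃ (ξ : ℝ) (D : ℝ → ℝ), 0 < ξ ∧ Measurable D ∧ (∀ y, 0 ≤ D y) ∧ MemLp D 2 (μ.map Y₀) ∧
      ∀ᵐ y ∂(μ.map Y₀), ∀ θ ∈ Θ, ‖θ - θ₀‖ ≤ ξ → |T θ y - T θ₀ y| ≤ D y * ‖θ - θ₀‖ := by
  obtain ⟨ξ, δ, d, hξ, hδ, hd, hexp⟩ := hs.expansion
  obtain ⟨r, hr, hball⟩ := Metric.isOpen_iff.1 hs.open_params θ₀ hθ₀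
  set t : ℝ := min (r / 2) ξ with ht
  have ht0 : 0 < t := by positivity
  have htr : t < r := (min_le_left _ _).trans_lt (by linarith)
  -- The expansion at these points of $\Theta$ bounds each partial derivative by square integrable
  -- quantities.
  set e : Fin q → Vec q := fun s => θ₀ + EuclideanSpace.single s t with he
  have hnorm : ∀ s, ‖e s - θ₀‖ = t := fun s => by
    simp [he, abs_of_pos ht0]
  have hmem : ∀ s, e s ∈ Θ := fun s => hball (by
    rw [Metric.mem_ball, dist_eq_norm, hnorm]; exact htr)
  -- A measurable version of $d$, so that the envelope is measurable.
  set d' : ℝ → ℝ := hd.1.mk d with hd'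
  have hd'm : Measurable d' := hd.1.stronglyMeasurable_mk.measurable
  have hd'L : MemLp d' 2 (μ.map Y₀) := hd.ae_eq hd.1.ae_eq_mk
  have hTm : ∀ θ ∈ Θ, Measurable (T θ) := fun θ hθ => (hs.strictMono θ hθ).monotone.measurable
  have hTL : ∀ θ ∈ Θ, MemLp (T θ) 2 (μ.map Y₀) := fun θ hθ =>
    (memLp_map_measure_iff (hTm θ hθ).aestronglyMeasurable hY.aemeasurable).2
      (hs.sq_integrable θ hθ)
  set b : Fin q → ℝ → ℝ := fun s y =>
    t⁻¹ * (|T (e s) y| + |T θ₀ y| + |d' y| * t ^ (1 + δ)) with hb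
  have hb0 : ∀ s y, 0 ≤ b s y := fun s y => by positivity
  refine ⟨ξ, fun y => ∑ s, b s y + |d' y| * ξ ^ δ, hξ, ?_, fun y => ?_, ?_, ?_⟩
  · refine (Finset.measurable_sum _ fun s _ => ?_).add ?_
    · have := hTm _ (hmem s); have := hTm _ hθ₀
      fun_prop
    · fun_prop
  · exact add_nonneg (Finset.sum_nonneg fun s _ => hb0 s y) (by positivity)
  · refine (memLp_finsetSum _ fun s _ => ?_).add (hd'L.abs.mul_const _)
    exact (((hTL _ (hmem s)).abs.add (hTL _ hθ₀).abs).add (hd'L.abs.mul_const _)).const_mul _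
  · filter_upwards [hexp, hd.1.ae_eq_mk] with y hy hdy θ hθ hθξ
    have hdle : d y ≤ |d' y| := by rw [hdy]; exact le_abs_self _
    have hpd : ∀ s, |paramDeriv T θ₀ s y| ≤ b s y := by
      intro s
      have h1 := hy (e s) (hmem s) (by rw [hnorm]; exact min_le_right _ _)
      have h2 : ∑ s', (e s s' - θ₀ s') * paramDeriv T θ₀ s' y = t * paramDeriv T θ₀ s y := by
        rw [Finset.sum_eq_single s]
        · simp [he]
        · intro s' _ hne
          simp [he, hne]
        · simp
      rw [h2, hnorm] at h1
      have h3 : d y * t ^ (1 + δ) ≤ |d' y| * t ^ (1 + δ) := by gcongr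
      have h4 : |t * paramDeriv T θ₀ s y| ≤ |T (e s) y| + |T θ₀ y| + |d' y| * t ^ (1 + δ) := by
        have e1 : t * paramDeriv T θ₀ s y = T (e s) y - T θ₀ y
            - (T (e s) y - T θ₀ y - t * paramDeriv T θ₀ s y) := by ring
        rw [e1]
        refine (abs_sub _ _).trans (add_le_add (abs_sub _ _) (h1.trans h3))
      rw [abs_mul, abs_of_pos ht0] at h4
      rw [hb]
      simp only
      rw [inv_mul_eq_div, le_div_iff₀ ht0, mul_comm]
      exact h4
    have h1 := hy θ hθ hθξ
    have h2 : |∑ s, (θ s - θ₀ s) * paramDeriv T θ₀ s y| ≤ (∑ s, b s y) * ‖θ - θ₀‖ := by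
      refine (Finset.abs_sum_le_sum_abs _ _).trans ?_
      rw [Finset.sum_mul]
      refine Finset.sum_le_sum fun s _ => ?_
      rw [abs_mul, mul_comm]
      refine mul_le_mul (hpd s) ?_ (abs_nonneg _) (hb0 s y)
      simpa using PiLp.norm_apply_le (θ - θ₀) s
    -- Within radius $\xi$ the remainder is linear in the increment; a zero increment is separated
    -- because the exponent is split.
    have h3 : d y * ‖θ - θ₀‖ ^ (1 + δ) ≤ |d' y| * ξ ^ δ * ‖θ - θ₀‖ := by
      rcases (norm_nonneg (θ - θ₀)).eq_or_lt with h0 | h0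
      · rw [← h0, Real.zero_rpow (by positivity)]; simp
      · rw [Real.rpow_add h0, Real.rpow_one, mul_comm ‖θ - θ₀‖, ← mul_assoc]
        gcongr
    calc |T θ y - T θ₀ y|
        ≤ |T θ y - T θ₀ y - ∑ s, (θ s - θ₀ s) * paramDeriv T θ₀ s y|
          + |∑ s, (θ s - θ₀ s) * paramDeriv T θ₀ s y| := by
          have := abs_add_le (T θ y - T θ₀ y - ∑ s, (θ s - θ₀ s) * paramDeriv T θ₀ s y)
            (∑ s, (θ s - θ₀ s) * paramDeriv T θ₀ s y)
          rwa [sub_add_cancel] at this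
      _ ≤ |d' y| * ξ ^ δ * ‖θ - θ₀‖ + (∑ s, b s y) * ‖θ - θ₀‖ := add_le_add (h1.trans h3) h2
      _ = _ := by ring

end Envelope

/-! ### The covariate density and conditional expectations -/

section Density

variable {Ω : Type*} [MeasurableSpace Ω] {μ : Measure Ω} {p : ℕ} {X₀ : Ω → Vec p}
  {R : Set (Vec p)} {f : Vec p → ℝ}

/-- The density is bounded only on $R$, so the law is first restricted to $R$, which carries it. -/
lemma DensityCondition.exists_map_le (hd : DensityCondition μ X₀ R f) (hX : Measurable X₀)
    (hR : MeasurableSet R) (hmem : ∀ᵐ ω ∂μ, X₀ ω ∈ R) :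
    ∃ C : ℝ≥0∞, C ≠ ∞ ∧ μ.map X₀ ≤ C • volume := by
  obtain ⟨c, C, -, hb⟩ := hd.bounds
  refine ⟨ENNReal.ofReal C, ENNReal.ofReal_ne_top, ?_⟩
  have hmem' : ∀ᵐ x ∂(μ.map X₀), x ∈ R := (ae_map_iff hX.aemeasurable hR).2 hmem
  rw [← Measure.restrict_eq_self_of_ae_mem hmem', hd.density, restrict_withDensity hR]
  calc (volume.restrict R).withDensity (fun a => ENNReal.ofReal (f a))
      ≤ (volume.restrict R).withDensity (fun _ => ENNReal.ofReal C) := by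
        refine withDensity_mono ?_
        filter_upwards [ae_restrict_mem hR] with x hx
        exact ENNReal.ofReal_le_ofReal (hb x hx).2
    _ = ENNReal.ofReal C • volume.restrict R := withDensity_const _
    _ ≤ ENNReal.ofReal C • volume := by
        gcongr
        exact Measure.restrict_le_self

lemma DensityCondition.integral_map (hd : DensityCondition μ X₀ R f) (g : Vec p → ℝ) :
    ∫ x, g x ∂(μ.map X₀) = ∫ x, g x * f x := by
  rw [hd.density, integral_withDensity_eq_integral_toReal_smul hd.measurable.ennreal_ofReal
    (ae_of_all _ fun _ => ENNReal.ofReal_lt_top)]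
  refine integral_congr_ae (ae_of_all _ fun x => ?_)
  simp only
  rw [ENNReal.toReal_ofReal (hd.nonneg x), smul_eq_mul, mul_comm]

lemma DensityCondition.integrable_mul (hd : DensityCondition μ X₀ R f) (hX : Measurable X₀)
    {g : Vec p → ℝ} (hg : Measurable g) (hint : Integrable (fun ω => g (X₀ ω)) μ) :
    Integrable fun x => g x * f x := by
  have h1 : Integrable g (μ.map X₀) :=
    (integrable_map_measure hg.aestronglyMeasurable hX.aemeasurable).2 hint
  rw [hd.density, integrable_withDensity_iff hd.measurable.ennreal_ofReal
    (ae_of_all _ fun _ => ENNReal.ofReal_lt_top)] at h1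
  refine h1.congr (ae_of_all _ fun x => ?_)
  simp only
  rw [ENNReal.toReal_ofReal (hd.nonneg x)]

/-- If `G` is a version of `E(W | X = ·)`, then `E(φ(X) W) = ∫ φ G f`. -/
lemma DensityCondition.integral_mul_eq [IsProbabilityMeasure μ] (hd : DensityCondition μ X₀ R f)
    (hX : Measurable X₀) {W : Ω → ℝ} (hW : Integrable W μ) {G : Vec p → ℝ} (hG : Measurable G)
    (hGW : (fun ω => G (X₀ ω)) =ᵐ[μ] μ[W | MeasurableSpace.comap X₀ inferInstance])
    {φ : Vec p → ℝ} (hφ : Measurable φ) (hb : ∃ b, ∀ x, |φ x| ≤ b) :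
    ∫ ω, φ (X₀ ω) * W ω ∂μ = ∫ x, φ x * (G x * f x) := by
  obtain ⟨b, hb⟩ := hb
  have hle := hX.comap_le
  have hφX : StronglyMeasurable[MeasurableSpace.comap X₀ inferInstance] fun ω => φ (X₀ ω) :=
    (hφ.comp (comap_measurable X₀)).stronglyMeasurable
  have h1 := condExp_stronglyMeasurable_mul_of_bound hle hφX hW b (ae_of_all _ fun ω => hb _)
  calc ∫ ω, φ (X₀ ω) * W ω ∂μ
      = ∫ ω, (μ[(fun ω => φ (X₀ ω)) * W | MeasurableSpace.comap X₀ inferInstance]) ω ∂μ :=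
        (integral_condExp hle).symm
    _ = ∫ ω, φ (X₀ ω) * G (X₀ ω) ∂μ := by
        refine integral_congr_ae ?_
        filter_upwards [h1, hGW] with ω h2 h3
        rw [h2, Pi.mul_apply, h3]
    _ = ∫ x, φ x * G x ∂(μ.map X₀) :=
        (MeasureTheory.integral_map hX.aemeasurable (hφ.mul hG).aestronglyMeasurable).symm
    _ = _ := by
        rw [hd.integral_map]
        simp only [mul_assoc]

end Density

/-! ### Conditional second moments -/

section Regression

variable {Ω : Type*} [MeasurableSpace Ω] {μ : Measure Ω} [IsProbabilityMeasure μ] {p : ℕ}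
  {X₀ : Ω → Vec p} {W : Ω → ℝ} {m σ : Vec p → ℝ}

/-- The conditional second moment is `m² + σ²`. -/
lemma IsCondSD.condExp_sq (hσ : IsCondSD μ X₀ W σ) (hm : IsCondMean μ X₀ W m) (hX : Measurable X₀)
    (hW : MemLp W 2 μ) :
    (fun ω => m (X₀ ω) ^ 2 + σ (X₀ ω) ^ 2)
      =ᵐ[μ] μ[fun ω => W ω ^ 2 | MeasurableSpace.comap X₀ inferInstance] := by
  have h := condVar_ae_eq_condExp_sq_sub_sq_condExp hX.comap_le hW
  filter_upwards [h, hσ.2.2, hm.2] with ω h1 h2 h3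
  have h4 : (W ^ 2 : Ω → ℝ) = fun ω => W ω ^ 2 := rfl
  rw [h3, h2, h1, Pi.sub_apply, Pi.pow_apply, h4]
  ring

end Regression

/-! ### Residuals are close to the errors on average -/

section Residuals

/-- Used with $a$ an increment in the parameter and $b$ its envelope. Absolute values are taken
termwise, since kernel weights may be negative. -/
lemma enorm_average_mul_le {n : ℕ} {w a b : ℕ → ℝ} {r : ℝ} (hr : 0 ≤ r)
    (hab : ∀ v < n, |a v| ≤ r * |b v|) :
    ‖(n : ℝ)⁻¹ * ∑ v ∈ Finset.range n, w v * a v‖ₑ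
      ≤ ENNReal.ofReal r * ‖(n : ℝ)⁻¹ * ∑ v ∈ Finset.range n, |w v * b v|‖ₑ := by
  refine (enorm_average_le_average_abs _ _).trans ?_
  rw [← ofReal_norm, ← ofReal_norm, ← ENNReal.ofReal_mul hr]
  refine ENNReal.ofReal_le_ofReal ?_
  have h1 : 0 ≤ (n : ℝ)⁻¹ * ∑ v ∈ Finset.range n, |w v * a v| :=
    mul_nonneg (inv_nonneg.2 (Nat.cast_nonneg n)) (Finset.sum_nonneg fun _ _ => abs_nonneg _)
  have h2 : 0 ≤ (n : ℝ)⁻¹ * ∑ v ∈ Finset.range n, |w v * b v| :=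
    mul_nonneg (inv_nonneg.2 (Nat.cast_nonneg n)) (Finset.sum_nonneg fun _ _ => abs_nonneg _)
  rw [Real.norm_of_nonneg h1, Real.norm_of_nonneg h2, mul_left_comm]
  refine mul_le_mul_of_nonneg_left ?_ (inv_nonneg.2 (Nat.cast_nonneg n))
  rw [Finset.mul_sum]
  refine Finset.sum_le_sum fun v hv => ?_
  rw [abs_mul, abs_mul, mul_left_comm]
  exact mul_le_mul_of_nonneg_left (hab v (Finset.mem_range.1 hv)) (abs_nonneg _)

/-- Factor the difference of squares and use $2|b|D\le b^2+D^2$; $r\le1$ keeps the bound linear in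
$r$. The envelope is integrable when $b$ and $D$ are square integrable. -/
lemma abs_sq_sub_sq_le {a b D r : ℝ} (hr0 : 0 ≤ r) (hr1 : r ≤ 1) (hD : 0 ≤ D)
    (h : |a - b| ≤ r * D) : |a ^ 2 - b ^ 2| ≤ r * |b ^ 2 + 2 * D ^ 2| := by
  have h1 : |a + b| ≤ 2 * |b| + D := by
    have : a + b = (a - b) + 2 * b := by ring
    rw [this]
    refine (abs_add_le _ _).trans ?_
    rw [abs_mul, abs_two]
    nlinarith
  have h2 : a ^ 2 - b ^ 2 = (a - b) * (a + b) := by ring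
  rw [h2, abs_mul, abs_of_nonneg (by positivity : 0 ≤ b ^ 2 + 2 * D ^ 2)]
  calc |a - b| * |a + b| ≤ (r * D) * (2 * |b| + D) := by gcongr
    _ = r * (2 * |b| * D + D ^ 2) := by ring
    _ ≤ r * (b ^ 2 + 2 * D ^ 2) := by
        refine mul_le_mul_of_nonneg_left ?_ hr0
        rw [← sq_abs b]
        nlinarith [sq_nonneg (|b| - D)]

variable {Ω : Type*} [MeasurableSpace Ω] {μ : Measure Ω} [IsProbabilityMeasure μ] {p q : ℕ}
  {Y : ℕ → Ω → ℝ} {X : ℕ → Ω → Vec p} {R : Set (Vec p)} {Θ : Set (Vec q)}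
  {T : Vec q → ℝ → ℝ} {θhat : ℕ → Ω → Vec q} {θ₀ : Vec q} {m : Vec q → Vec p → ℝ}
  {m₀ σ₀ : Vec p → ℝ} {f : Vec p → ℝ} {k : ℝ → ℝ} {h : ℕ → ℝ}

/-- The residuals are close to the errors on average, in probability. -/
theorem tendsto_measure_truncDist_residual
    (hm : IsCondMean μ (X 0) (fun ω => T θ₀ (Y 0 ω)) m₀)
    (hσ : IsCondSD μ (X 0) (fun ω => T θ₀ (Y 0 ω)) σ₀)
    (hsample : IIDSample μ Y X R) (hkernel : KernelCondition p k) (hband : BandwidthCondition p h)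
    (hdens : DensityCondition μ (X 0) R f) (hσpos : ∀ᵐ ω ∂μ, 0 < σ₀ (X 0 ω))
    (hsmooth : SmoothTransformations μ (Y 0) (X 0) Θ T m θ₀) (hmem : ∀ n ω, θhat n ω ∈ Θ)
    (hθ₀ : θ₀ ∈ Θ) (hθhat : TendstoInMeasure μ θhat atTop (fun _ => θ₀))
    {η : ℝ≥0∞} (hη : 0 < η) :
    Tendsto (fun n => μ {ω | η < truncDist n
        (residual n (h n) k (T (θhat n ω)) (fun j => Y j ω) (fun j => X j ω))
        (fun j => modelError (T θ₀) m₀ σ₀ (Y j) (X j) ω)}) atTop (𝓝 0) := by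
  set Z : ℕ → Ω → ℝ × Vec p := fun j ω => (Y j ω, X j ω) with hZdef
  have hZ : ∀ j, Measurable (Z j) := fun j =>
    (hsample.measurable_Y j).prodMk (hsample.measurable_X j)
  have hind : iIndepFun Z μ := hsample.indep
  set P := μ.map (Z 0) with hP
  have hlaw : ∀ j, μ.map (Z j) = P := fun j => (hsample.ident j).map_eq
  have : IsProbabilityMeasure P := Measure.isProbabilityMeasure_map (hZ 0).aemeasurable
  have hX0 := hsample.measurable_X 0
  have hY0 := hsample.measurable_Y 0
  have hRm : MeasurableSet R := hsample.compact.measurableSet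
  have hPsnd : P.map Prod.snd = μ.map (X 0) := by
    rw [hP, Measure.map_map measurable_snd (hZ 0)]; rfl
  have hPfst : P.map Prod.fst = μ.map (Y 0) := by
    rw [hP, Measure.map_map measurable_fst (hZ 0)]; rfl
  obtain ⟨C, hCfin, hC⟩ := hdens.exists_map_le hX0 hRm hsample.mem
  rw [← hPsnd] at hC
  obtain ⟨ξ, D, hξ, hDm, hD0, hDL, hDb⟩ := hsmooth.exists_envelope hY0 hθ₀
  set τ := T θ₀ with hτ
  have hτm : Measurable τ := (hsmooth.strictMono θ₀ hθ₀).monotone.measurable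
  have hτL : MemLp (fun ω => τ (Y 0 ω)) 2 μ := hsmooth.sq_integrable θ₀ hθ₀
  have hDL' : MemLp (fun ω => D (Y 0 ω)) 2 μ :=
    (memLp_map_measure_iff hDm.aestronglyMeasurable hY0.aemeasurable).1 hDL
  -- kernel averages
  have hPint : ∀ {g : ℝ → ℝ}, Measurable g → Integrable (fun ω => g (Y 0 ω)) μ →
      Integrable (fun z : ℝ × Vec p => g z.1) P := fun hg hi =>
    (integrable_map_measure (hg.comp measurable_fst).aestronglyMeasurable
      (hZ 0).aemeasurable).2 hi
  have hτ1 : Integrable (fun ω => τ (Y 0 ω)) μ := hτL.integrable one_le_two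
  have hτ2 : Integrable (fun ω => τ (Y 0 ω) ^ 2) μ := hτL.integrable_sq
  have hD1 : Integrable (fun ω => D (Y 0 ω)) μ := hDL'.integrable one_le_two
  have hD2 : Integrable (fun ω => τ (Y 0 ω) ^ 2 + 2 * D (Y 0 ω) ^ 2) μ :=
    hτ2.add (hDL'.integrable_sq.const_mul 2)
  have hcons : ∀ {g : ℝ → ℝ} {G : Vec p → ℝ}, Measurable g → Measurable G →
      Integrable (fun ω => g (Y 0 ω)) μ → (fun ω => G (X 0 ω)) =ᵐ[μ]
        μ[fun ω => g (Y 0 ω) | MeasurableSpace.comap (X 0) inferInstance] →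
      ∀ {ε : ℝ≥0∞}, 0 < ε → ∀ᶠ n : ℕ in atTop, ∀ j < n, ∫⁻ ω, ‖(n : ℝ)⁻¹ *
        ∑ v ∈ Finset.range n, scaledKernel k (h n) (X j ω - X v ω) * g (Y v ω)
          - G (X j ω) * f (X j ω)‖ₑ ∂μ ≤ ε := by
    intro g G hg hG hgi hgG ε hε
    have hGi : Integrable (fun ω => G (X 0 ω)) μ := integrable_condExp.congr hgG.symm
    refine eventually_lintegral_kernel_average_sub_le (g := fun z => g z.1)
      (F := fun x => G x * f x) hZ hind hlaw hC hCfin hkernel hband (hg.comp measurable_fst)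
      (hPint hg hgi) (hG.mul hdens.measurable) (hdens.integrable_mul hX0 hG hGi) ?_ hε
    intro φ hφ hb
    have hφg : Measurable fun z : ℝ × Vec p => φ z.2 * g z.1 := by fun_prop
    rw [hP, integral_map (hZ 0).aemeasurable hφg.aestronglyMeasurable]
    exact hdens.integral_mul_eq hX0 hgi hG hgG hφ hb
  have hcons₀ : ∀ {ε : ℝ≥0∞}, 0 < ε → ∀ᶠ n : ℕ in atTop, ∀ j < n, ∫⁻ ω, ‖(n : ℝ)⁻¹ *
      ∑ v ∈ Finset.range n, scaledKernel k (h n) (X j ω - X v ω) * 1 - f (X j ω)‖ₑ ∂μ ≤ ε := by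
    intro ε hε
    have := hcons (g := fun _ => 1) (G := fun _ => 1) measurable_const measurable_const
      (integrable_const _) (by rw [condExp_const hX0.comap_le]) hε
    simpa using this
  have hcons₁ := fun {ε : ℝ≥0∞} (hε : 0 < ε) => hcons hτm hm.1 hτ1 hm.2 hε
  have hcons₂ := fun {ε : ℝ≥0∞} (hε : 0 < ε) => hcons (g := fun y => τ y ^ 2)
    (G := fun x => m₀ x ^ 2 + σ₀ x ^ 2) (hτm.pow_const 2) ((hm.1.pow_const 2).add
      (hσ.1.pow_const 2)) hτ2 (hσ.condExp_sq hm hX0 hτL) hε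
  -- bounded kernel averages
  obtain ⟨M, hM0, hM⟩ := hkernel.exists_bound_productKernel
  have hKm := hkernel.measurable_productKernel
  have hKi := hkernel.integrable_productKernel
  set L : ℝ≥0∞ := ∫⁻ u : Vec p, ‖productKernel k u‖ₑ with hL
  have hLfin : L ≠ ∞ := hKi.2.ne
  -- Needed for the envelopes $D$ and $\tau^2+2D^2$, whose averages need only stay bounded since
  -- they are multiplied by a small $r$.
  have hbdd : ∀ᶠ n : ℕ in atTop, ∀ {g : ℝ → ℝ}, Measurable g → ∀ j < n, ∫⁻ ω, ‖(n : ℝ)⁻¹ *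
      ∑ v ∈ Finset.range n, |scaledKernel k (h n) (X j ω - X v ω) * g (Y v ω)|‖ₑ ∂μ
        ≤ (C * L + 1) * ∫⁻ z, ‖g z.1‖ₑ ∂P := by
    have hlimA : Tendsto (fun n : ℕ => M * ((n : ℝ) * h n ^ p)⁻¹) atTop (𝓝 0) := by
      simpa using hband.tendsto_inv.const_mul M
    filter_upwards [hlimA.eventually_le_const zero_lt_one] with n hn g hg j hj
    have hhp : 0 < h n ^ p := pow_pos (hband.1 n) p
    have hκB : ∀ u : Vec p, |scaledKernel k (h n) u| ≤ (h n ^ p)⁻¹ * M := fun u => by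
      rw [scaledKernel, abs_mul, abs_of_pos (inv_pos.2 hhp)]
      exact mul_le_mul_of_nonneg_left (hM _) (by positivity)
    refine (lintegral_kernel_average_le (g := fun z => g z.1) hZ hind hlaw hC
      (measurable_scaledKernel hKm _) (hg.comp measurable_fst) hκB hj).trans ?_
    rw [lintegral_scaledKernel hKi (hband.1 n)]
    refine mul_le_mul_left (add_le_add le_rfl ?_) _
    rw [← ENNReal.ofReal_one]
    refine ENNReal.ofReal_le_ofReal (le_trans (le_of_eq ?_) hn)
    rw [mul_inv]
    ring
  -- the vectors to which the continuous mapping argument applies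
  set vfun : ℝ × Vec p → ℝ × ℝ × ℝ × ℝ := fun z =>
    (f z.2, m₀ z.2 * f z.2, (m₀ z.2 ^ 2 + σ₀ z.2 ^ 2) * f z.2, τ z.1) with hvfun
  have hvm : Measurable vfun := by
    have h1 := hdens.measurable
    have h2 := hm.1
    have h3 := hσ.1
    fun_prop
  have hfpos : ∀ᵐ ω ∂μ, 0 < f (X 0 ω) := by
    obtain ⟨c, C', hc, hb⟩ := hdens.bounds
    filter_upwards [hsample.mem] with ω hω
    exact hc.trans_le (hb _ hω).1
  have hfpos' : ∀ j, ∀ᵐ ω ∂μ, 0 < f (X j ω) := by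
    intro j
    have hset : MeasurableSet {z : ℝ × Vec p | 0 < f z.2} :=
      measurableSet_lt measurable_const (hdens.measurable.comp measurable_snd)
    have h1 : ∀ᵐ z ∂P, 0 < f z.2 := (ae_map_iff (hZ 0).aemeasurable hset).2 hfpos
    rw [← hlaw j] at h1
    exact (ae_map_iff (hZ j).aemeasurable hset).1 h1
  set V : ℕ → Ω → ℝ × ℝ × ℝ × ℝ := fun j ω => vfun (Z j ω) with hV
  have hVm : ∀ j, Measurable (V j) := fun j => hvm.comp (hZ j)
  have hVlaw : ∀ j, μ.map (V j) = P.map vfun := fun j => by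
    rw [← hlaw j, Measure.map_map hvm (hZ j)]; rfl
  have : IsProbabilityMeasure (P.map vfun) := Measure.isProbabilityMeasure_map hvm.aemeasurable
  -- For the limit vector the gap in the second inequality of the domain is $(f\sigma)^2$.
  have hνU : P.map vfun studentizeDomainᶜ = 0 := by
    rw [← hVlaw 0]
    refine (ae_map_iff (hVm 0).aemeasurable isOpen_studentizeDomain.measurableSet).2 ?_
    filter_upwards [hfpos, hσpos] with ω h1 h2
    refine ⟨h1, ?_⟩
    change (m₀ (X 0 ω) * f (X 0 ω)) ^ 2
      < f (X 0 ω) * ((m₀ (X 0 ω) ^ 2 + σ₀ (X 0 ω) ^ 2) * f (X 0 ω))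
    have : 0 < (f (X 0 ω) * σ₀ (X 0 ω)) ^ 2 := by positivity
    nlinarith
  set Vhat : ℕ → ℕ → Ω → ℝ × ℝ × ℝ × ℝ := fun n j ω =>
    (kernelAverage n (h n) k (fun j => X j ω) (fun _ => 1) (X j ω),
      kernelAverage n (h n) k (fun j => X j ω) (fun v => T (θhat n ω) (Y v ω)) (X j ω),
      kernelAverage n (h n) k (fun j => X j ω) (fun v => T (θhat n ω) (Y v ω) ^ 2) (X j ω),
      T (θhat n ω) (Y j ω)) with hVhat
  -- the exceptional null set of the Lipschitz bound
  have henv : ∀ᵐ ω ∂μ, ∀ j, ∀ θ ∈ Θ, ‖θ - θ₀‖ ≤ ξ →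
      |T θ (Y j ω) - τ (Y j ω)| ≤ D (Y j ω) * ‖θ - θ₀‖ := by
    rw [ae_all_iff]
    intro j
    have hYj : μ.map (Y j) = μ.map (Y 0) := by
      have : μ.map (Y j) = (μ.map (Z j)).map Prod.fst := by
        rw [Measure.map_map measurable_fst (hZ j)]; rfl
      rw [this, hlaw j, hPfst]
    rw [← hYj] at hDb
    exact ae_of_ae_map (hsample.measurable_Y j).aemeasurable hDb
  have hkey := tendsto_measure_truncDist_of_continuousOn (Vhat := Vhat) hVm hVlaw
    isOpen_studentizeDomain hνU continuousOn_studentize ?_ hη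
  · refine hkey.congr fun n => measure_congr ?_
    filter_upwards [ae_all_iff.2 hfpos'] with ω hω
    refine congrArg (fun s => η < s) ?_
    simp only [truncDist]
    congr 1
    refine Finset.sum_congr rfl fun j _ => ?_
    rw [residual_eq_studentize]
    simp only [hV, hvfun, hZdef, studentize_eq (hω j) (hσ.2.1 _), modelError]
    rfl
  intro ρ hρ
  set I₁ : ℝ≥0∞ := ∫⁻ z : ℝ × Vec p, ‖D z.1‖ₑ ∂P with hI₁
  set I₂ : ℝ≥0∞ := ∫⁻ z : ℝ × Vec p, ‖τ z.1 ^ 2 + 2 * D z.1 ^ 2‖ₑ ∂P with hI₂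
  have hg₂m : Measurable fun y => τ y ^ 2 + 2 * D y ^ 2 := by fun_prop
  have hI₁fin : I₁ ≠ ∞ := (hPint hDm hD1).2.ne
  have hI₂fin : I₂ ≠ ∞ := (hPint hg₂m hD2).2.ne
  have hρ4 : 0 < ρ / 4 := ENNReal.div_pos hρ.ne' (by simp)
  -- A radius for $\hat\theta$: at most $\xi$ for the envelope, at most $1$ for the squares, and so
  -- small that all parameter increments together cost $\rho/4$ in mean.
  obtain ⟨r, hr0, hrξ, hr1, hr⟩ : ∃ r : ℝ, 0 < r ∧ r ≤ ξ ∧ r ≤ 1 ∧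
      ENNReal.ofReal r * ((C * L + 1) * I₁ + (C * L + 1) * I₂ + I₁) ≤ ρ / 4 := by
    have hc : ((C * L + 1) * I₁ + (C * L + 1) * I₂ + I₁) ≠ ∞ := by finiteness
    have h1 : Tendsto (fun r : ℝ => ENNReal.ofReal r *
        ((C * L + 1) * I₁ + (C * L + 1) * I₂ + I₁)) (𝓝[>] 0) (𝓝 0) := by
      have h2 : Tendsto (fun r : ℝ => ENNReal.ofReal r) (𝓝[>] 0) (𝓝 0) := by
        have := (ENNReal.continuous_ofReal.tendsto 0).mono_left
          (nhdsWithin_le_nhds (s := Set.Ioi (0 : ℝ)))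
        simpa using this
      simpa using ENNReal.Tendsto.mul_const h2 (Or.inr hc)
    have h3 : ∀ᶠ r : ℝ in 𝓝[>] 0, r ≤ min ξ 1 :=
      (eventually_le_nhds (lt_min hξ one_pos)).filter_mono nhdsWithin_le_nhds
    obtain ⟨r, ⟨h4, h5⟩, h6⟩ :=
      (((h1.eventually_le_const hρ4).and h3).and self_mem_nhdsWithin).exists
    exact ⟨r, h6, h5.trans (min_le_left _ _), h5.trans (min_le_right _ _), h4⟩
  set N : Set Ω := {ω | ¬ ∀ j, ∀ θ ∈ Θ, ‖θ - θ₀‖ ≤ ξ →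
      |T θ (Y j ω) - τ (Y j ω)| ≤ D (Y j ω) * ‖θ - θ₀‖} with hN
  have hN0 : μ N = 0 := henv
  refine ⟨fun n => {ω | r ≤ ‖θhat n ω - θ₀‖} ∪ N, ?_⟩
  filter_upwards [(tendstoInMeasure_iff_norm.1 hθhat r hr0).eventually_le_const hρ,
    hcons₀ hρ4, hcons₁ hρ4, hcons₂ hρ4, hbdd] with n hn hn₀ hn₁ hn₂ hnb
  refine ⟨(measure_union_le _ _).trans (by rw [hN0, add_zero]; exact hn), ?_⟩
  have hscale := measurable_scaledKernel hKm (h n)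
  have hav : ∀ j {g : ℝ → ℝ}, Measurable g → Measurable fun ω => (n : ℝ)⁻¹ *
      ∑ v ∈ Finset.range n, scaledKernel k (h n) (X j ω - X v ω) * g (Y v ω) := by
    intro j g hg
    refine (Finset.measurable_sum _ fun v _ => ?_).const_mul _
    have := hsample.measurable_X j
    have := hsample.measurable_X v
    have := hsample.measurable_Y v
    fun_prop
  have hav' : ∀ j {g : ℝ → ℝ}, Measurable g → Measurable fun ω => (n : ℝ)⁻¹ *
      ∑ v ∈ Finset.range n, |scaledKernel k (h n) (X j ω - X v ω) * g (Y v ω)| := by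
    intro j g hg
    refine (Finset.measurable_sum _ fun v _ => ?_).const_mul _
    have := hsample.measurable_X j
    have := hsample.measurable_X v
    have := hsample.measurable_Y v
    fun_prop
  set W₀ : ℕ → Ω → ℝ≥0∞ := fun j ω => ‖(n : ℝ)⁻¹ *
    ∑ v ∈ Finset.range n, scaledKernel k (h n) (X j ω - X v ω) * 1 - f (X j ω)‖ₑ with hW₀
  set W₁ : ℕ → Ω → ℝ≥0∞ := fun j ω => ‖(n : ℝ)⁻¹ *
    ∑ v ∈ Finset.range n, scaledKernel k (h n) (X j ω - X v ω) * τ (Y v ω)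
      - m₀ (X j ω) * f (X j ω)‖ₑ with hW₁
  set W₂ : ℕ → Ω → ℝ≥0∞ := fun j ω => ‖(n : ℝ)⁻¹ *
    ∑ v ∈ Finset.range n, scaledKernel k (h n) (X j ω - X v ω) * τ (Y v ω) ^ 2
      - (m₀ (X j ω) ^ 2 + σ₀ (X j ω) ^ 2) * f (X j ω)‖ₑ with hW₂
  set B₁ : ℕ → Ω → ℝ≥0∞ := fun j ω => ‖(n : ℝ)⁻¹ *
    ∑ v ∈ Finset.range n, |scaledKernel k (h n) (X j ω - X v ω) * D (Y v ω)|‖ₑ with hB₁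
  set B₂ : ℕ → Ω → ℝ≥0∞ := fun j ω => ‖(n : ℝ)⁻¹ *
    ∑ v ∈ Finset.range n, |scaledKernel k (h n) (X j ω - X v ω)
      * (τ (Y v ω) ^ 2 + 2 * D (Y v ω) ^ 2)|‖ₑ with hB₂
  have hW₀m : ∀ j, Measurable (W₀ j) := fun j =>
    ((hav j (g := fun _ => 1) measurable_const).sub
      (hdens.measurable.comp (hsample.measurable_X j))).enorm
  have hW₁m : ∀ j, Measurable (W₁ j) := fun j =>
    ((hav j hτm).sub ((hm.1.mul hdens.measurable).comp (hsample.measurable_X j))).enorm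
  have hW₂m : ∀ j, Measurable (W₂ j) := fun j =>
    ((hav j (g := fun y => τ y ^ 2) (hτm.pow_const 2)).sub ((((hm.1.pow_const 2).add
      (hσ.1.pow_const 2)).mul hdens.measurable).comp (hsample.measurable_X j))).enorm
  have hB₁m : ∀ j, Measurable (B₁ j) := fun j => (hav' j hDm).enorm
  have hB₂m : ∀ j, Measurable (B₂ j) := fun j => (hav' j hg₂m).enorm
  have hDYm : ∀ j, Measurable fun ω => ‖D (Y j ω)‖ₑ := fun j =>
    (hDm.comp (hsample.measurable_Y j)).enorm
  -- The bound does not involve $\hat\theta$, hence is measurable although joint measurability of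
  -- $T$ is not assumed.
  refine ⟨fun j ω => W₀ j ω + W₁ j ω + W₂ j ω
    + ENNReal.ofReal r * (B₁ j ω + B₂ j ω + ‖D (Y j ω)‖ₑ), fun j => ?_, fun j hj => ⟨?_, ?_⟩⟩
  · exact (((hW₀m j).add (hW₁m j)).add (hW₂m j)).add
      ((((hB₁m j).add (hB₂m j)).add (hDYm j)).const_mul _)
  · have hBm : Measurable fun ω => B₁ j ω + B₂ j ω := (hB₁m j).add (hB₂m j)
    have hBDm : Measurable fun ω => B₁ j ω + B₂ j ω + ‖D (Y j ω)‖ₑ := hBm.add (hDYm j)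
    have hWm : Measurable fun ω => W₀ j ω + W₁ j ω + W₂ j ω :=
      ((hW₀m j).add (hW₁m j)).add (hW₂m j)
    have hlast : ∫⁻ ω, ENNReal.ofReal r * (B₁ j ω + B₂ j ω + ‖D (Y j ω)‖ₑ) ∂μ ≤ ρ / 4 := by
      rw [lintegral_const_mul _ hBDm,
        lintegral_add_right _ (hDYm j), lintegral_add_right _ (hB₂m j)]
      refine le_trans (mul_le_mul_right (add_le_add (add_le_add (hnb hDm j hj)
        (hnb hg₂m j hj)) (le_of_eq ?_)) _) hr
      have hDfst : Measurable fun z : ℝ × Vec p => ‖D z.1‖ₑ := by fun_prop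
      rw [hI₁, ← hlaw j, lintegral_map hDfst (hZ j)]
    simp only
    rw [lintegral_add_left hWm,
      lintegral_add_right _ (hW₂m j), lintegral_add_right _ (hW₁m j)]
    refine (add_le_add (add_le_add (add_le_add (hn₀ j hj) (hn₁ j hj)) (hn₂ j hj)) hlast).trans
      (le_of_eq ?_)
    have : ρ / 4 + ρ / 4 + ρ / 4 + ρ / 4 = ρ / 4 * 4 := by ring
    rw [this, ENNReal.div_mul_cancel (by simp) (by simp)]
  · intro ω hω
    rw [Set.mem_union, not_or] at hω
    obtain ⟨hω₁, hω₂⟩ := hω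
    have hθr : ‖θhat n ω - θ₀‖ ≤ r := (not_le.1 hω₁).le
    have hb : ∀ v, |T (θhat n ω) (Y v ω) - τ (Y v ω)| ≤ r * D (Y v ω) := by
      intro v
      have := not_not.1 hω₂ v (θhat n ω) (hmem n ω) (hθr.trans hrξ)
      refine this.trans ?_
      rw [mul_comm]
      exact mul_le_mul_of_nonneg_right hθr (hD0 _)
    have hsplit : ∀ (a b w : ℕ → ℝ) (c : ℝ),
        ‖(n : ℝ)⁻¹ * ∑ v ∈ Finset.range n, w v * a v - c‖ₑ
          ≤ ‖(n : ℝ)⁻¹ * ∑ v ∈ Finset.range n, w v * b v - c‖ₑ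
            + ‖(n : ℝ)⁻¹ * ∑ v ∈ Finset.range n, w v * (a v - b v)‖ₑ := by
      intro a b w c
      refine le_trans (le_of_eq ?_) (enorm_add_le _ _)
      congr 1
      simp only [mul_sub, Finset.sum_sub_distrib]
      ring
    have e₀ : edist (f (X j ω))
        (kernelAverage n (h n) k (fun j => X j ω) (fun _ => 1) (X j ω)) ≤ W₀ j ω := by
      rw [edist_comm, edist_eq_enorm_sub, kernelAverage_eq_sum_scaledKernel]
    have e₁ : edist (m₀ (X j ω) * f (X j ω)) (kernelAverage n (h n) k (fun j => X j ω)
        (fun v => T (θhat n ω) (Y v ω)) (X j ω)) ≤ W₁ j ω + ENNReal.ofReal r * B₁ j ω := by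
      rw [edist_comm, edist_eq_enorm_sub, kernelAverage_eq_sum_scaledKernel]
      refine (hsplit _ (fun v => τ (Y v ω)) _ _).trans (add_le_add le_rfl ?_)
      refine enorm_average_mul_le hr0.le fun v _ => ?_
      rw [abs_of_nonneg (hD0 _)]
      exact hb v
    have e₂ : edist ((m₀ (X j ω) ^ 2 + σ₀ (X j ω) ^ 2) * f (X j ω))
        (kernelAverage n (h n) k (fun j => X j ω) (fun v => T (θhat n ω) (Y v ω) ^ 2) (X j ω))
        ≤ W₂ j ω + ENNReal.ofReal r * B₂ j ω := by
      rw [edist_comm, edist_eq_enorm_sub, kernelAverage_eq_sum_scaledKernel]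
      refine (hsplit _ (fun v => τ (Y v ω) ^ 2) _ _).trans (add_le_add le_rfl ?_)
      exact enorm_average_mul_le hr0.le fun v _ => abs_sq_sub_sq_le hr0.le hr1 (hD0 _) (hb v)
    have e₃ : edist (τ (Y j ω)) (T (θhat n ω) (Y j ω)) ≤ ENNReal.ofReal r * ‖D (Y j ω)‖ₑ := by
      rw [edist_comm, edist_eq_enorm_sub, ← ofReal_norm, ← ofReal_norm,
        ← ENNReal.ofReal_mul hr0.le, Real.norm_of_nonneg (hD0 _)]
      exact ENNReal.ofReal_le_ofReal (hb j)
    have htotal : W₀ j ω + W₁ j ω + W₂ j ω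
        + ENNReal.ofReal r * (B₁ j ω + B₂ j ω + ‖D (Y j ω)‖ₑ)
        = W₀ j ω + ((W₁ j ω + ENNReal.ofReal r * B₁ j ω) + ((W₂ j ω + ENNReal.ofReal r * B₂ j ω)
          + ENNReal.ofReal r * ‖D (Y j ω)‖ₑ)) := by ring
    simp only
    rw [htotal]
    -- The distance on the product is the maximum over coordinates, and each coordinate has its own
    -- block of the sum.
    refine max_le (e₀.trans le_self_add) (le_trans (max_le (e₁.trans le_self_add)
      (le_trans (max_le (e₂.trans le_self_add) (e₃.trans le_add_self)) le_add_self)) le_add_self)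

end Residuals

/-! ### The weight measure -/

section Weights

variable {Ω : Type*} [MeasurableSpace Ω] {μ : Measure Ω} {p : ℕ} {w₁ : ℝ → ℝ} {w₂ : Vec p → ℝ}

/-- The measure on the frequency domain with density `w₁(t₁) w₂(t₂)`. -/
def weightMeasure (w₁ : ℝ → ℝ) (w₂ : Vec p → ℝ) : Measure (ℝ × Vec p) :=
  volume.withDensity fun t => ENNReal.ofReal (w₁ t.1 * w₂ t.2)

instance : SigmaFinite (weightMeasure w₁ w₂) := SigmaFinite.withDensity_ofReal _

lemma isFiniteMeasure_weightMeasure (h₁ : Integrable w₁) (h₂ : Integrable w₂) :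
    IsFiniteMeasure (weightMeasure w₁ w₂) :=
  isFiniteMeasure_withDensity_ofReal (h₁.mul_prod h₂).2

lemma lintegral_weightMeasure (hw₁ : Measurable w₁) (hw₂ : Measurable w₂)
    {φ : ℝ × Vec p → ℂ} (hφ : Measurable φ) :
    ∫⁻ t, ENNReal.ofReal (‖φ t‖ ^ 2) ∂(weightMeasure w₁ w₂)
      = ∫⁻ t, ENNReal.ofReal (‖φ t‖ ^ 2 * (w₁ t.1 * w₂ t.2)) := by
  have hφ2 : Measurable fun t => ENNReal.ofReal (‖φ t‖ ^ 2) := by fun_prop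
  have hw : Measurable fun t : ℝ × Vec p => ENNReal.ofReal (w₁ t.1 * w₂ t.2) := by fun_prop
  rw [weightMeasure, lintegral_withDensity_eq_lintegral_mul _ hw hφ2]
  refine lintegral_congr fun t => ?_
  rw [Pi.mul_apply, mul_comm, ← ENNReal.ofReal_mul (by positivity)]

lemma measurable_empiricalContrast (n : ℕ) (x : ℕ → Vec p) (e : ℕ → ℝ) :
    Measurable (empiricalContrast n x e) := by
  unfold empiricalContrast empiricalCF
  fun_prop

lemma measurable_populationContrast [SFinite μ] {X : Ω → Vec p} (hX : Measurable X) {ε : Ω → ℝ}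
    (hε : Measurable ε) : Measurable (populationContrast μ X ε) := by
  have hjm := measurable_jointCF (μ := μ) hX hε
  unfold populationContrast
  exact hjm.sub ((hjm.comp (g := _) (f := fun t : ℝ × Vec p => ((0 : ℝ), t.2)) (by fun_prop)).mul
    (hjm.comp (g := _) (f := fun t : ℝ × Vec p => (t.1, (0 : Vec p))) (by fun_prop)))

lemma testStatistic_eq (hw₁ : Measurable w₁) (hw₂ : Measurable w₂) (n : ℕ) (h : ℝ) (k τ : ℝ → ℝ)
    (y : ℕ → ℝ) (x : ℕ → Vec p) :
    testStatistic n h k w₁ w₂ τ y x = n * ∫⁻ t,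
      ENNReal.ofReal (‖empiricalContrast n x (residual n h k τ y x) t‖ ^ 2)
        ∂(weightMeasure w₁ w₂) := by
  rw [lintegral_weightMeasure hw₁ hw₂ (measurable_empiricalContrast _ _ _)]
  rfl

lemma cfDistance_eq [SFinite μ] (hw₁ : Measurable w₁) (hw₂ : Measurable w₂) {X : Ω → Vec p}
    (hX : Measurable X) {ε : Ω → ℝ} (hε : Measurable ε) :
    cfDistance μ X ε w₁ w₂ = ∫⁻ t, ENNReal.ofReal (‖populationContrast μ X ε t‖ ^ 2)
      ∂(weightMeasure w₁ w₂) := by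
  rw [lintegral_weightMeasure hw₁ hw₂ (measurable_populationContrast hX hε), cfDistance]
  simp only [charFun_map_eq_jointCF_left hX ε, charFun_map_eq_jointCF_right X hε,
    populationContrast]

end Weights

/-- Otherwise $\varphi$ would vanish almost everywhere on each spanning set, hence on their union.
This handles weights of infinite mass. -/
lemma exists_lintegral_restrict_spanningSets_pos {α : Type*} [MeasurableSpace α] (ν : Measure α)
    [SigmaFinite ν] {φ : α → ℝ≥0∞} (hφ : Measurable φ) (hpos : 0 < ∫⁻ t, φ t ∂ν) :
    ∃ N, 0 < ∫⁻ t, φ t ∂(ν.restrict (spanningSets ν N)) := by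
  by_contra! hcon
  have h1 : ∀ N, ∀ᵐ t ∂(ν.restrict (spanningSets ν N)), φ t = 0 := fun N =>
    (lintegral_eq_zero_iff hφ).1 (nonpos_iff_eq_zero.1 (hcon N))
  rw [← ae_restrict_iUnion_iff, iUnion_spanningSets, Measure.restrict_univ] at h1
  exact hpos.ne' ((lintegral_eq_zero_iff hφ).2 h1)

end TransformationTest

end

/-! ### Consistency of the test -/

theorem theorem2 {Ω : Type*} [MeasurableSpace Ω] (μ : MeasureTheory.Measure Ω)
    [MeasureTheory.IsProbabilityMeasure μ] {p q : ℕ}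
    -- the data `(Y_j, X_j)`, the transformations `T_θ`, `θ ∈ Θ`, and the estimators `θhat n`
    (Y : ℕ → Ω → ℝ) (X : ℕ → Ω → TransformationTest.Vec p) (R : Set (TransformationTest.Vec p))
    (Θ : Set (TransformationTest.Vec q)) (T : TransformationTest.Vec q → ℝ → ℝ)
    (θhat : ℕ → Ω → TransformationTest.Vec q) (θ₀ : TransformationTest.Vec q)
    -- versions of the conditional means and standard deviations of `T_θ(Y)` given `X`
    (m σ : TransformationTest.Vec q → TransformationTest.Vec p → ℝ)
    (f : TransformationTest.Vec p → ℝ)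
    -- kernel, bandwidths, weights
    (k : ℝ → ℝ) (h : ℕ → ℝ) (w₁ : ℝ → ℝ) (w₂ : TransformationTest.Vec p → ℝ)
    (hm : ∀ θ ∈ Θ, TransformationTest.IsCondMean μ (X 0) (fun ω => T θ (Y 0 ω)) (m θ))
    (hσ : ∀ θ ∈ Θ, TransformationTest.IsCondSD μ (X 0) (fun ω => T θ (Y 0 ω)) (σ θ))
    (hsample : TransformationTest.IIDSample μ Y X R)
    (hkernel : TransformationTest.KernelCondition p k)
    (hband : TransformationTest.BandwidthCondition p h)
    (hdens : TransformationTest.DensityCondition μ (X 0) R f)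
    (hreg : TransformationTest.RegressionCondition μ (X 0) R (m θ₀) (σ θ₀))
    (hsmooth : TransformationTest.SmoothTransformations μ (Y 0) (X 0) Θ T m θ₀)
    (hweight : TransformationTest.WeightCondition w₁ w₂)
    (hlip : TransformationTest.LipschitzTransformations μ (Y 0) Θ T θ₀)
    -- the estimator converges in probability to some `θ₀ ∈ Θ`
    (hθhat_meas : ∀ n, Measurable (θhat n)) (hθhat_mem : ∀ n ω, θhat n ω ∈ Θ)
    (hθ₀ : θ₀ ∈ Θ)
    (hθhat : MeasureTheory.TendstoInMeasure μ θhat Filter.atTop (fun _ => θ₀))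
    -- at `θ₀` covariates and errors are dependent
    (halt : 0 < TransformationTest.cfDistance μ (X 0)
      (TransformationTest.modelError (T θ₀) (m θ₀) (σ θ₀) (Y 0) (X 0)) w₁ w₂) :
    -- the statistic tends to infinity in probability
    TransformationTest.TendstoInProb μ
      (fun n ω => TransformationTest.testStatistic n (h n) k w₁ w₂ (T (θhat n ω))
        (fun j => Y j ω) (fun j => X j ω)) ⊤ ∧
    -- divided by `n` it tends to the (then finite) distance if the weights are integrable
    (MeasureTheory.Integrable w₁ → MeasureTheory.Integrable w₂ →
      TransformationTest.cfDistance μ (X 0)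
        (TransformationTest.modelError (T θ₀) (m θ₀) (σ θ₀) (Y 0) (X 0)) w₁ w₂ ≠ ⊤ ∧
      TransformationTest.TendstoInProb μ
        (fun n ω => TransformationTest.testStatistic n (h n) k w₁ w₂ (T (θhat n ω))
          (fun j => Y j ω) (fun j => X j ω) / (n : ENNReal))
        (TransformationTest.cfDistance μ (X 0)
          (TransformationTest.modelError (T θ₀) (m θ₀) (σ θ₀) (Y 0) (X 0)) w₁ w₂)) ∧
    -- consistency: with critical values bounded in probability, the test rejects with
    -- probability tending to one
    (∀ c : ℕ → Ω → ℝ, TransformationTest.BoundedAboveInProb μ c →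
      Filter.Tendsto (fun n => μ {ω | ENNReal.ofReal (c n ω) <
        TransformationTest.testStatistic n (h n) k w₁ w₂ (T (θhat n ω))
          (fun j => Y j ω) (fun j => X j ω)}) Filter.atTop (nhds 1)) := by
  open TransformationTest in
  set τ := T θ₀ with hτ
  set ε : ℕ → Ω → ℝ := fun j => modelError τ (m θ₀) (σ θ₀) (Y j) (X j) with hε
  have hX := hsample.measurable_X
  have hτm : Measurable τ := (hsmooth.strictMono θ₀ hθ₀).monotone.measurable
  have hmm := (hm θ₀ hθ₀).1
  have hσm := (hσ θ₀ hθ₀).1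
  have herr : Measurable fun z : ℝ × Vec p => ((τ z.1 - m θ₀ z.2) / σ θ₀ z.2, z.2) := by fun_prop
  have hεm : ∀ j, Measurable (ε j) := fun j =>
    (measurable_fst.comp herr).comp ((hsample.measurable_Y j).prodMk (hX j))
  -- The pairs of error and covariate are images of the data under one measurable map, so they are
  -- again i.i.d.
  have hind : ProbabilityTheory.iIndepFun (fun j ω => (ε j ω, X j ω)) μ :=
    hsample.indep.comp (fun _ => _) fun _ => herr
  have hident : ∀ j, ProbabilityTheory.IdentDistrib (fun ω => (ε j ω, X j ω))
      (fun ω => (ε 0 ω, X 0 ω)) μ μ := fun j => (hsample.ident j).comp herr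
  have hres : ∀ η > 0, Filter.Tendsto (fun n => μ {ω | η < truncDist n
      (residual n (h n) k (T (θhat n ω)) (fun j => Y j ω) (fun j => X j ω))
      (fun j => ε j ω)}) Filter.atTop (nhds 0) := fun η hη =>
    tendsto_measure_truncDist_residual (hm θ₀ hθ₀) (hσ θ₀ hθ₀) hsample hkernel hband hdens
      hreg.sd_pos hsmooth hθhat_mem hθ₀ hθhat hη
  have hconv : ∀ (ν : MeasureTheory.Measure (ℝ × Vec p)) [MeasureTheory.IsFiniteMeasure ν], _ :=
    fun ν _ => tendstoInProb_lintegral_contrast hX hεm hind hident ν hres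
  have hw₁ := hweight.measurable₁
  have hw₂ := hweight.measurable₂
  have hdist := cfDistance_eq (μ := μ) hw₁ hw₂ (hX 0) (hεm 0)
  have hdiv : TendstoInProb μ (fun n ω => testStatistic n (h n) k w₁ w₂ (T (θhat n ω))
      (fun j => Y j ω) (fun j => X j ω)) ⊤ := by
    change 0 < cfDistance μ (X 0) (ε 0) w₁ w₂ at halt
    rw [hdist] at halt
    have hpm := measurable_populationContrast (μ := μ) (hX 0) (hεm 0)
    obtain ⟨N, hN⟩ := exists_lintegral_restrict_spanningSets_pos _
      (by fun_prop : Measurable fun t =>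
        ENNReal.ofReal (‖populationContrast μ (X 0) (ε 0) t‖ ^ 2)) halt
    have : MeasureTheory.IsFiniteMeasure ((weightMeasure w₁ w₂).restrict
        (MeasureTheory.spanningSets (weightMeasure w₁ w₂) N)) :=
      ⟨by
        rw [MeasureTheory.Measure.restrict_apply_univ]
        exact MeasureTheory.measure_spanningSets_lt_top _ _⟩
    -- Restricting the frequency measure only lowers the statistic, so its divergence follows from
    -- the finite piece.
    refine tendstoInProb_top_of_mul_le hN (hconv _) fun n ω => ?_
    rw [testStatistic_eq hw₁ hw₂]
    exact mul_le_mul_right (MeasureTheory.lintegral_mono' MeasureTheory.Measure.restrict_le_self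
      le_rfl) _
  refine ⟨hdiv, fun hi₁ hi₂ => ?_, fun c hc => hdiv.tendsto_measure_lt hc⟩
  have hfin := isFiniteMeasure_weightMeasure hi₁ hi₂
  change cfDistance μ (X 0) (ε 0) w₁ w₂ ≠ ⊤ ∧ TendstoInProb μ _ (cfDistance μ (X 0) (ε 0) w₁ w₂)
  rw [hdist]
  refine ⟨?_, fun U hU => ?_⟩
  · refine ne_top_of_le_ne_top (b := ∫⁻ _, ENNReal.ofReal (2 ^ 2) ∂(weightMeasure w₁ w₂)) ?_ ?_
    · simp [ENNReal.mul_eq_top]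
    · exact MeasureTheory.lintegral_mono fun t => ENNReal.ofReal_le_ofReal
        (pow_le_pow_left₀ (norm_nonneg _) (norm_populationContrast_le _ _ _) 2)
  · refine (hconv (weightMeasure w₁ w₂) U hU).congr' ?_
    -- The factor $n$ cancels only for $n>0$.
    filter_upwards [Filter.eventually_gt_atTop 0] with n hn
    have hn0 : (n : ENNReal) ≠ 0 := by exact_mod_cast hn.ne'
    simp only [testStatistic_eq hw₁ hw₂,
      mul_comm (n : ENNReal), ENNReal.mul_div_cancel_right hn0 (ENNReal.natCast_ne_top n)]
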